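/- Let $(W,J)$ be an almost complex manifold with boundary, of real dimension $2n+2$ with $n\ge 0$: $W$ is a smooth (Hausdorff, second countable) manifold with boundary and $J$ is a smooth section of $\operatorname{End}(TW)$ with $J^2=-\mathbf 1$. Let $M:=\partial W$, with its structure of a smooth $(2n+1)$-dimensional manifold, and let $\xi := TM\cap (J\cdot TM)$ be the subbundle of complex tangencies of $M$. For a smooth function $h$ let $d^Jh$ be the $1$-form $d^Jh(v)=-dh(Jv)$. Then the following are equivalent. (1) The boundary $M$ is $J$-convex: there is a smooth function $h\colon W\to(-\infty,0]$ such that $0$ is a regular value of $h$, $\partial W=h^{-1}(0)$, and $h$ is $J$-plurisubharmonic on a neighborhood of $\partial W$, that is, $dd^Jh(v,Jv)>0$ for every non-zero tangent vector $v$ at every point of that neighborhood. (2) The subbundle $\xi$ is a cooriented contact structure whose natural orientation is the boundary orientation of $M$ and whose natural conformal symplectic structure tames $J|_\xi$: there is a smooth $1$-form $\alpha$ on $M$ with $\ker\alpha=\xi$ such that $\alpha\wedge(d\alpha)^n$ is a volume form, this volume form is positive for the boundary orientation of $M$ (outward vector first, where $W$ is oriented by $J$), and $d\alpha(v,Jv)>0$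 for every non-zero $v\in\xi$. -/

import Mathlib

open scoped Manifold ContDiff

noncomputable section

namespace JConvex

/-! ### One-forms on smooth manifolds, possibly with boundary -/

section OneForms

variable {E : Type*} [NormedAddCommGroup E] [NormedSpace ℝ E] {H : Type*} [TopologicalSpace H]

/-- A smooth `1`-form: a family of continuous linear functionals on the tangent spaces which is a
smooth section of the cotangent bundle `Hom(TX, ℝ)`. -/
def IsSmoothOneForm (I : ModelWithCorners ℝ E H) {X : Type*} [TopologicalSpace X]
    [ChartedSpace H X] [IsManifold I ∞ X] (α : (x : X) → TangentSpace I x →L[ℝ] ℝ) : Prop :=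
  ContMDiff I (I.prod 𝓘(ℝ, E →L[ℝ] ℝ)) ∞
    (fun x => Bundle.TotalSpace.mk' (E →L[ℝ] ℝ)
      (E := fun x : X => TangentSpace I x →L[ℝ] Bundle.Trivial X ℝ x) x (α x))

/-- The coordinate expression `(φ⁻¹)^* α` of a `1`-form `α` in the preferred chart `φ` at `x`. -/
def oneFormInChart (I : ModelWithCorners ℝ E H) {X : Type*} [TopologicalSpace X]
    [ChartedSpace H X] (α : (x : X) → TangentSpace I x →L[ℝ] ℝ) (x : X) (y : E) : E →L[ℝ] ℝ :=
  (α ((extChartAt I x).symm y)).comp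
    (mfderivWithin 𝓘(ℝ, E) I (extChartAt I x).symm (Set.range I) y)

/-- The exterior derivative `dα` of a `1`-form, as a bilinear expression in two tangent vectors at
`x`; it is the exterior derivative of the coordinate expression of `α` in the preferred chart at
`x`. (In Mathlib the tangent space at `x` is the model vector space, the identification being the
derivative at `x` of that chart.) -/
def extDerivOneForm (I : ModelWithCorners ℝ E H) {X : Type*} [TopologicalSpace X]
    [ChartedSpace H X] (α : (x : X) → TangentSpace I x →L[ℝ] ℝ) (x : X)
    (v w : TangentSpace I x) : ℝ :=
  extDerivWithin
    (fun y : E => ContinuousAlternatingMap.ofSubsingleton ℝ E ℝ (0 : Fin 1)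
      (oneFormInChart I α x y))
    (Set.range I) (extChartAt I x x) (![v, w] : Fin 2 → E)

end OneForms

/-! ### Almost complex structures and plurisubharmonic functions -/

section AlmostComplex

variable {E : Type*} [NormedAddCommGroup E] [NormedSpace ℝ E] {H : Type*} [TopologicalSpace H]

/-- An almost complex structure: a smooth section `J` of `End(TW)` with `J² = -1`. -/
structure AlmostComplexStructure (I : ModelWithCorners ℝ E H) (W : Type*) [TopologicalSpace W]
    [ChartedSpace H W] [IsManifold I ∞ W] where
  toFun : (p : W) → TangentSpace I p →L[ℝ] TangentSpace I p
  smooth : ContMDiff I (I.prod 𝓘(ℝ, E →L[ℝ] E)) ∞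
    (fun p => Bundle.TotalSpace.mk' (E →L[ℝ] E)
      (E := fun p : W => TangentSpace I p →L[ℝ] TangentSpace I p) p (toFun p))
  sq_eq_neg : ∀ (p : W) (v : TangentSpace I p), toFun p (toFun p v) = -v

variable {I : ModelWithCorners ℝ E H} {W : Type*} [TopologicalSpace W] [ChartedSpace H W]
  [IsManifold I ∞ W]

/-- The `1`-form `d^J h = -dh ∘ J`. -/
def dJ (J : AlmostComplexStructure I W) (h : W → ℝ) (p : W) : TangentSpace I p →L[ℝ] ℝ :=
  -((mfderiv I 𝓘(ℝ, ℝ) h p : TangentSpace I p →L[ℝ] ℝ).comp (J.toFun p))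

/-- `h` is `J`-plurisubharmonic on the set `U`: the form `dd^J h` is strictly positive on
`J`-complex lines at all points of `U`. -/
def IsPlurisubharmonicOn (J : AlmostComplexStructure I W) (h : W → ℝ) (U : Set W) : Prop :=
  ∀ p ∈ U, ∀ v : TangentSpace I p, v ≠ 0 →
    0 < extDerivOneForm I (dJ J h) p v (J.toFun p v)

/-- `W` has `J`-convex boundary: there is a smooth `h : W → (-∞, 0]` which is
`J`-plurisubharmonic on a neighbourhood of `∂W`, has `0` as a regular value, and satisfies
`∂W = h⁻¹(0)`. -/
def HasJConvexBoundary (J : AlmostComplexStructure I W) : Prop :=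
  ∃ h : W → ℝ, ContMDiff I 𝓘(ℝ, ℝ) ∞ h ∧ (∀ p, h p ≤ 0) ∧
    (∃ U : Set W, IsOpen U ∧ I.boundary W ⊆ U ∧ IsPlurisubharmonicOn J h U) ∧
    (∀ p, h p = 0 → Function.Surjective (mfderiv I 𝓘(ℝ, ℝ) h p)) ∧
    h ⁻¹' {0} = I.boundary W

end AlmostComplex

/-! ### Contact forms -/

/-- The value of `a ∧ β^n` on `2n + 1` vectors, for a linear form `a` and an alternating bilinear
form `β`, with the normalisation for which `(a ∧ β)(u, v, w)` is the cyclic sum of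
`a(u) β(v, w)`. -/
def wedgePow {V : Type*} (n : ℕ) (a : V → ℝ) (β : V → V → ℝ) (v : Fin (2 * n + 1) → V) : ℝ :=
  (1 / 2 ^ n) * ∑ σ : Equiv.Perm (Fin (2 * n + 1)),
    ((Equiv.Perm.sign σ : ℤ) : ℝ) * a (v (σ 0)) *
      ∏ i : Fin n, β (v (σ ⟨2 * i + 1, by omega⟩)) (v (σ ⟨2 * i + 2, by omega⟩))

section Contact

variable {n : ℕ} {M : Type*} [TopologicalSpace M] [ChartedSpace (EuclideanSpace ℝ (Fin (2 * n + 1))) M]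
  [IsManifold (𝓡 (2 * n + 1)) ∞ M]

/-- The top-degree form `α ∧ (dα)^n` on a `(2n+1)`-dimensional manifold. -/
def contactVolume (α : (x : M) → TangentSpace (𝓡 (2 * n + 1)) x →L[ℝ] ℝ) (x : M)
    (v : Fin (2 * n + 1) → TangentSpace (𝓡 (2 * n + 1)) x) : ℝ :=
  wedgePow n (fun u : TangentSpace (𝓡 (2 * n + 1)) x => α x u)
    (extDerivOneForm (𝓡 (2 * n + 1)) α x) v

/-- A contact form on a `(2n+1)`-dimensional manifold: a smooth `1`-form `α` such that
`α ∧ (dα)^n` vanishes nowhere. -/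
def IsContactForm (α : (x : M) → TangentSpace (𝓡 (2 * n + 1)) x →L[ℝ] ℝ) : Prop :=
  IsSmoothOneForm (𝓡 (2 * n + 1)) α ∧
    ∀ x, ∃ v : Fin (2 * n + 1) → TangentSpace (𝓡 (2 * n + 1)) x, contactVolume α x v ≠ 0

end Contact

/-! ### Orientations -/

/-- `v` is a positive frame for the orientation of the complex vector space `(V, J)`, i.e. for the
orientation defined by any basis `(e₀, J e₀, …, eₙ, J eₙ)`. -/
def IsJPositive {V : Type*} [AddCommGroup V] [Module ℝ V] {n : ℕ} (J : V → V)
    (v : Fin (2 * n + 2) → V) : Prop :=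
  ∃ b : Module.Basis (Fin (2 * n + 2)) ℝ V,
    (∀ i : Fin (n + 1), b ⟨2 * i + 1, by omega⟩ = J (b ⟨2 * i, by omega⟩)) ∧ 0 < b.det v

/-! ### The boundary of an almost complex manifold -/

section Boundary

variable {n : ℕ} {W : Type*} [TopologicalSpace W] [ChartedSpace (EuclideanHalfSpace (2 * n + 2)) W]
  [IsManifold (𝓡∂ (2 * n + 2)) ∞ W]
  {M : Type*} [TopologicalSpace M] [ChartedSpace (EuclideanSpace ℝ (Fin (2 * n + 1))) M]
  [IsManifold (𝓡 (2 * n + 1)) ∞ M]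

/-- The differential `T_x M → T_{ι x} W` of a map `ι : M → W`. -/
def dIncl (ι : M → W) (x : M) :
    TangentSpace (𝓡 (2 * n + 1)) x →L[ℝ] TangentSpace (𝓡∂ (2 * n + 2)) (ι x) :=
  mfderiv (𝓡 (2 * n + 1)) (𝓡∂ (2 * n + 2)) ι x

/-- `ι : M → W` exhibits `M` as the boundary of `W`: it is a smooth embedding (a smooth
topological embedding with injective differentials) with image `∂W`. This determines `M` up to a
unique diffeomorphism over `W`. -/
structure IsBoundaryInclusion (ι : M → W) : Prop where
  contMDiff : ContMDiff (𝓡 (2 * n + 1)) (𝓡∂ (2 * n + 2)) ∞ ι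
  isEmbedding : Topology.IsEmbedding ι
  injective_dIncl : ∀ x, Function.Injective (dIncl (n := n) ι x)
  range_eq : Set.range ι = (𝓡∂ (2 * n + 2)).boundary W

/-- The fibre at `x` of the bundle `ξ = TM ∩ J·TM` of complex tangencies, as a subspace of
`T_x M`. -/
def complexTangencies (J : AlmostComplexStructure (𝓡∂ (2 * n + 2)) W) (ι : M → W) (x : M) :
    Submodule ℝ (TangentSpace (𝓡 (2 * n + 1)) x) :=
  (LinearMap.range (dIncl ι x).toLinearMap ⊓
      (LinearMap.range (dIncl ι x).toLinearMap).map (J.toFun (ι x)).toLinearMap).comap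
    (dIncl ι x).toLinearMap

/-- A tangent vector at a boundary point `p` of `W` points outwards: in the chart at `p`, with
values in the half-space `{y₀ ≥ 0}`, its `0`-th coordinate is negative. -/
def IsOutward (p : W) (Y : TangentSpace (𝓡∂ (2 * n + 2)) p) : Prop :=
  (show EuclideanSpace ℝ (Fin (2 * n + 2)) from Y) 0 < 0

/-- `v` is a positive frame of `T_x M` for the boundary orientation (outward vector first), where
`W` is oriented by `J`. -/
def IsBoundaryPositive (J : AlmostComplexStructure (𝓡∂ (2 * n + 2)) W) (ι : M → W) (x : M)
    (v : Fin (2 * n + 1) → TangentSpace (𝓡 (2 * n + 1)) x) : Prop :=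
  ∃ Y : TangentSpace (𝓡∂ (2 * n + 2)) (ι x), IsOutward (ι x) Y ∧
    IsJPositive (n := n) (J.toFun (ι x)) (Fin.cons Y fun i => dIncl ι x (v i))

/-- The orientation of `M` given by `α ∧ (dα)^n` is the boundary orientation. -/
def InducesBoundaryOrientation (J : AlmostComplexStructure (𝓡∂ (2 * n + 2)) W) (ι : M → W)
    (α : (x : M) → TangentSpace (𝓡 (2 * n + 1)) x →L[ℝ] ℝ) : Prop :=
  ∀ (x : M) (v : Fin (2 * n + 1) → TangentSpace (𝓡 (2 * n + 1)) x),
    IsBoundaryPositive J ι x v → 0 < contactVolume α x v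

/-- `dα` tames the restriction of `J` to the complex tangencies: `dα(v, Jv) > 0` for all non-zero
`v ∈ ξ_x`. Here `w` is the vector `Jv`, seen in `T_x M`. -/
def TamesOnComplexTangencies (J : AlmostComplexStructure (𝓡∂ (2 * n + 2)) W) (ι : M → W)
    (α : (x : M) → TangentSpace (𝓡 (2 * n + 1)) x →L[ℝ] ℝ) : Prop :=
  ∀ (x : M), ∀ v ∈ complexTangencies J ι x, ∀ w ∈ complexTangencies J ι x, v ≠ 0 →
    dIncl ι x w = J.toFun (ι x) (dIncl ι x v) →
      0 < extDerivOneForm (𝓡 (2 * n + 1)) α x v w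

/-- The field `ξ` of complex tangencies is a cooriented contact structure whose natural
orientation is the boundary orientation and whose natural conformal symplectic structure tames
`J|_ξ`. The coorientation is recorded by a positive contact form `α`; the orientation
`α ∧ (dα)^n` and the conformal class of `dα|_ξ` depend only on the coorientation. -/
def TangenciesAreTamedContact (J : AlmostComplexStructure (𝓡∂ (2 * n + 2)) W) (ι : M → W) :
    Prop :=
  ∃ α : (x : M) → TangentSpace (𝓡 (2 * n + 1)) x →L[ℝ] ℝ,
    IsContactForm α ∧
    (∀ x, LinearMap.ker (α x).toLinearMap = complexTangencies J ι x) ∧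
    InducesBoundaryOrientation J ι α ∧
    TamesOnComplexTangencies J ι α

end Boundary

end JConvex

end

noncomputable section

namespace JConvex

/-! ### Alternating products of a linear form and powers of a bilinear form -/

section WedgePow

/-! Let `h ≤ 0` be any smooth function vanishing exactly on the boundary, with `dh ≠ 0` there. At
boundary points `TM = ker dh`, outward means `dh > 0` (`isOutward_iff`), and `v` lies in `ξ` exactly
when `dh(v) = dh(Jv) = 0`. So `ξ` is the kernel of `α₀ = ι^*(d^J h)` (`mem_complexTangencies_iff`),
and `dα₀` is the pull-back of `dd^J h` (`extDerivOneForm_pullback`).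

From (1) to (2): if `h` is plurisubharmonic near the boundary, `dα₀` tames `J` on `ξ`, and the rest
is linear algebra. On a real hyperplane `ker l` of a complex vector space put `a = -l ∘ J`. If a
skew form `β` tames `J` on `ker a`, then `a ∧ β^n` is positive for the boundary orientation
(`wedgePow_pos_of_isJPositive`). Since `β` need not be `J`-invariant, a complex frame need not be
symplectic; `exists_tame_frame` compares the two kinds of frame by induction on the dimension.

From (2) to (1): the given contact form is `α = c α₀`, and the orientation condition forces `c > 0`.
On `ξ` this gives `dα = c dα₀`, hence `dd^J h(v, Jv) > 0` there (`levi_pos`). The remaining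
directions are handled by replacing `h` with `h exp(c h / 2)`, which has the sign and the zeros of
`h` whatever `c` is. At the boundary this adds `c (dh(v)² + dh(Jv)²)` to the Levi form, a term
vanishing exactly on `ξ`. Compactness of the unit sphere gives a suitable `c` at each boundary
point, and it still works nearby. Suitable constants form a convex set and derivatives of `c` do not
enter at the boundary, so a partition of unity makes `c` a smooth function. Openness of
plurisubharmonicity (`eventually_plurisubharmonic`) then gives the neighbourhood. -/

lemma sign_mul_prod_nonneg {n : ℕ} (B : Fin n × Fin 2 → Fin n × Fin 2 → ℝ)
    (hskew : ∀ x y, B x y = -B y x) (hoff : ∀ x y, x.1 ≠ y.1 → B x y = 0)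
    (hpos : ∀ i, 0 < B (i, 0) (i, 1)) (π : Equiv.Perm (Fin n × Fin 2)) :
    0 ≤ ((Equiv.Perm.sign π : ℤ) : ℝ) * ∏ i, B (π (i, 0)) (π (i, 1)) := by
  -- A permutation contributes only if it carries each pair onto a pair; otherwise a factor of the
  -- product vanishes.
  by_cases h : ∀ i, (π (i, 0)).1 = (π (i, 1)).1
  swap
  · push Not at h
    obtain ⟨i, hi⟩ := h
    rw [Finset.prod_eq_zero (Finset.mem_univ i) (hoff _ _ hi), mul_zero]
  have hne : ∀ i, (π (i, 0)).2 ≠ (π (i, 1)).2 := by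
    intro i hi
    have : π (i, 0) = π (i, 1) := Prod.ext (h i) hi
    simpa using congrArg Prod.snd (π.injective this)
  have hinj : Function.Injective (fun i => (π (i, 0)).1) := by
    intro i k hik
    simp only at hik
    have hcase : π (k, 0) = π (i, 0) ∨ π (k, 0) = π (i, 1) := by
      have h2 : (π (k, 0)).2 = (π (i, 0)).2 ∨ (π (k, 0)).2 = (π (i, 1)).2 := by
        have := hne i
        omega
      rcases h2 with h2 | h2
      · exact Or.inl (Prod.ext hik.symm h2)
      · exact Or.inr (Prod.ext (hik.symm.trans (h i)) h2)
    rcases hcase with hc | hc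
    · exact (congrArg Prod.fst (π.injective hc)).symm
    · exact (congrArg Prod.fst (π.injective hc)).symm
  let τ : Equiv.Perm (Fin n) := Equiv.ofBijective _ (Finite.injective_iff_bijective.mp hinj)
  let f : Fin n → Equiv.Perm (Fin 2) := fun i => if (π (i, 0)).2 = 0 then 1 else Equiv.swap 0 1
  -- Such a `π` flips some pairs internally (`f`) and then permutes the pairs as blocks (`τ`).
  have hπ : π = (Equiv.prodCongrLeft fun _ : Fin 2 => τ) * Equiv.prodCongrRight f := by
    ext1 ⟨i, ε⟩
    have hτ : τ i = (π (i, 0)).1 := rfl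
    simp only [Equiv.Perm.mul_apply, Equiv.prodCongrRight_apply, Equiv.prodCongrLeft_apply, hτ]
    have h1 := h i
    have h2 := hne i
    by_cases h0 : (π (i, 0)).2 = 0
    · have h3 : (π (i, 1)).2 = 1 := by omega
      simp only [f, h0, if_true, Equiv.Perm.one_apply]
      fin_cases ε
      · exact Prod.ext rfl h0
      · exact Prod.ext h1.symm h3
    · have h3 : (π (i, 1)).2 = 0 := by omega
      have h4 : (π (i, 0)).2 = 1 := by omega
      simp only [f, h0, if_false]
      fin_cases ε
      · exact Prod.ext rfl (by simpa using h4)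
      · exact Prod.ext h1.symm (by simpa using h3)
  -- The block permutation acts as `τ` on two copies of `Fin n`, so it is even. Only the flips
  -- contribute signs, and each cancels against the skewness of `B`.
  have hsign : Equiv.Perm.sign π = ∏ i, Equiv.Perm.sign (f i) := by
    rw [hπ, Equiv.Perm.sign_mul, Equiv.Perm.sign_prodCongrRight, Equiv.Perm.sign_prodCongrLeft,
      Fin.prod_univ_two, Int.units_mul_self, one_mul]
  rw [hsign]
  push_cast
  rw [← Finset.prod_mul_distrib]
  refine Finset.prod_nonneg fun i _ => le_of_lt ?_
  have h1 := h i
  have h2 := hne i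
  by_cases h0 : (π (i, 0)).2 = 0
  · have h3 : (π (i, 1)).2 = 1 := by omega
    have e0 : π (i, 0) = (τ i, 0) := Prod.ext rfl h0
    have e1 : π (i, 1) = (τ i, 1) := Prod.ext h1.symm h3
    have hf : f i = 1 := if_pos h0
    rw [e0, e1, hf]
    simpa using hpos (τ i)
  · have h3 : (π (i, 1)).2 = 0 := by omega
    have h4 : (π (i, 0)).2 = 1 := by omega
    have e0 : π (i, 0) = (τ i, 1) := Prod.ext rfl h4
    have e1 : π (i, 1) = (τ i, 0) := Prod.ext h1.symm h3
    have hf : f i = Equiv.swap 0 1 := if_neg h0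
    rw [e0, e1, hf, hskew]
    simpa using hpos (τ i)

/-- The index `2i + 1 + ε` of the `ε`-th vector of the `i`-th pair. -/
def pairIdx {n : ℕ} (x : Fin n × Fin 2) : Fin (2 * n + 1) := ⟨2 * x.1 + 1 + x.2, by omega⟩

/-- The splitting of `Fin (2n + 1)` into `0` and `n` pairs. -/
def optionPairEquiv (n : ℕ) : Option (Fin n × Fin 2) ≃ Fin (2 * n + 1) :=
  Equiv.ofBijective (fun o => o.elim 0 pairIdx) <| by
    refine (Fintype.bijective_iff_injective_and_card _).mpr ⟨?_, by simp; ring⟩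
    rintro (_ | ⟨i, ε⟩) (_ | ⟨k, δ⟩) h
    · rfl
    · have : 0 = 2 * (k : ℕ) + 1 + δ := congrArg Fin.val h
      omega
    · have : 2 * (i : ℕ) + 1 + ε = 0 := congrArg Fin.val h
      omega
    · simp only [Option.elim_some, pairIdx, Fin.mk.injEq] at h
      congr 1
      ext <;> simp only <;> omega

/-- Only permutations fixing `0` survive, because `a` kills every other vector. These are
permutations of the pairs, so `sign_mul_prod_nonneg` makes all terms nonnegative, and the identity
gives a strictly positive one. -/
lemma wedgePow_pos_of_symplectic {V : Type*} {n : ℕ} (a : V → ℝ) (β : V → V → ℝ)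
    (hskew : ∀ x y, β x y = -β y x) (v : Fin (2 * n + 1) → V) (ha0 : 0 < a (v 0))
    (ha : ∀ j, j ≠ 0 → a (v j) = 0)
    (hpos : ∀ i : Fin n, 0 < β (v (pairIdx (i, 0))) (v (pairIdx (i, 1))))
    (hoff : ∀ x y : Fin n × Fin 2, x.1 ≠ y.1 → β (v (pairIdx x)) (v (pairIdx y)) = 0) :
    0 < wedgePow n a β v := by
  unfold wedgePow
  refine mul_pos (by positivity) (Finset.sum_pos' (fun σ _ => ?_) ⟨1, Finset.mem_univ _, ?_⟩)
  · by_cases h0 : σ 0 = 0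
    · let e := optionPairEquiv n
      let ρ : Equiv.Perm (Option (Fin n × Fin 2)) := e.symm.permCongr σ
      have he0 : e none = 0 := rfl
      have heS : ∀ x, e (some x) = pairIdx x := fun _ => rfl
      have hρ0 : ρ none = none := by
        simp only [ρ, Equiv.permCongr_apply, Equiv.symm_symm, he0, h0]
        rw [← he0, Equiv.symm_apply_apply]
      let π : Equiv.Perm (Fin n × Fin 2) := Equiv.removeNone ρ
      have hρ : ρ = Equiv.optionCongr π := by
        ext1 x
        cases x with
        | none => simp [hρ0]
        | some x =>
          have hx : ρ (some x) ≠ none := fun h =>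
            Option.some_ne_none x (ρ.injective (h.trans hρ0.symm))
          obtain ⟨y, hy⟩ := Option.ne_none_iff_exists'.mp hx
          rw [Equiv.optionCongr_apply, Option.map_some]
          exact (Equiv.removeNone_some ρ ⟨y, hy⟩).symm
      have hσ : ∀ x, σ (pairIdx x) = pairIdx (π x) := by
        intro x
        have : e.symm (σ (e (some x))) = some (π x) := by
          have := congrArg (fun r : Equiv.Perm (Option (Fin n × Fin 2)) => r (some x)) hρ
          simpa [ρ] using this
        rw [Equiv.symm_apply_eq] at this
        exact this
      have hs : Equiv.Perm.sign σ = Equiv.Perm.sign π := by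
        rw [← Equiv.Perm.sign_permCongr e.symm σ, ← Equiv.optionCongr_sign π, ← hρ]
      have := sign_mul_prod_nonneg (fun x y => β (v (pairIdx x)) (v (pairIdx y)))
        (fun x y => hskew _ _) hoff hpos π
      simp only [← hσ] at this
      rw [h0, hs, mul_right_comm]
      exact mul_nonneg this ha0.le
    · rw [ha _ h0, mul_zero, zero_mul]
  · simp only [Equiv.Perm.sign_one, Units.val_one, Int.cast_one, one_mul, Equiv.Perm.one_apply]
    exact mul_pos ha0 (Finset.prod_pos fun i _ => hpos i)

variable {V : Type*} [AddCommGroup V] [Module ℝ V]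

/-- `a(v₀) β(v₁, v₂) ⋯ β(v_{2n-1}, v_{2n})` as a multilinear form. -/
def wedgeMultilinear (n : ℕ) (a : V →ₗ[ℝ] ℝ) (β : V →ₗ[ℝ] V →ₗ[ℝ] ℝ) :
    MultilinearMap ℝ (fun _ : Fin (2 * n + 1) => V) ℝ :=
  -- Each slot occurs in exactly one factor, so the product is a linear form `L` in that slot.
  -- Additivity and homogeneity both follow from this.
  have key : ∀ (v : Fin (2 * n + 1) → V) (j : Fin (2 * n + 1)), ∃ L : V →ₗ[ℝ] ℝ, ∀ x,
      a (Function.update v j x 0) * ∏ i : Fin n,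
        β (Function.update v j x (pairIdx (i, 0))) (Function.update v j x (pairIdx (i, 1))) =
      L x := by
    intro v j
    obtain ⟨o, rfl⟩ := (optionPairEquiv n).surjective j
    have hinj : ∀ x y : Fin n × Fin 2, (pairIdx x = pairIdx y) = (x = y) := fun x y => by
      have := (optionPairEquiv n).injective.eq_iff (a := some x) (b := some y)
      simpa [optionPairEquiv] using this
    have h0 : ∀ x : Fin n × Fin 2, (0 : Fin (2 * n + 1)) ≠ pairIdx x := fun x h => by
      have : 0 = 2 * (x.1 : ℕ) + 1 + x.2 := congrArg Fin.val h
      omega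
    cases o with
    | none =>
      refine ⟨(∏ i : Fin n, β (v (pairIdx (i, 0))) (v (pairIdx (i, 1)))) • a, fun x => ?_⟩
      have : optionPairEquiv n none = 0 := rfl
      simp only [this, Function.update_self, Function.update_of_ne (h0 _).symm,
        LinearMap.smul_apply, smul_eq_mul, mul_comm]
    | some q =>
      obtain ⟨k, ε⟩ := q
      have hq : optionPairEquiv n (some (k, ε)) = pairIdx (k, ε) := rfl
      have hrest : ∀ x : V, ∏ i ∈ Finset.univ.erase k,
          β (Function.update v (pairIdx (k, ε)) x (pairIdx (i, 0)))
            (Function.update v (pairIdx (k, ε)) x (pairIdx (i, 1))) =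
          ∏ i ∈ Finset.univ.erase k, β (v (pairIdx (i, 0))) (v (pairIdx (i, 1))) := by
        intro x
        refine Finset.prod_congr rfl fun i hi => ?_
        have hik : i ≠ k := (Finset.mem_erase.mp hi).1
        rw [Function.update_of_ne, Function.update_of_ne] <;> simp [hinj, hik]
      set R := ∏ i ∈ Finset.univ.erase k, β (v (pairIdx (i, 0))) (v (pairIdx (i, 1))) with hR
      fin_cases ε
      · refine ⟨(a (v 0) * R) • β.flip (v (pairIdx (k, 1))), fun x => ?_⟩
        simp only [hq]
        rw [← Finset.mul_prod_erase _ _ (Finset.mem_univ k)]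
        erw [hrest x]
        rw [Function.update_of_ne (h0 _)]
        simp [hinj]
        ring
      · refine ⟨(a (v 0) * R) • β (v (pairIdx (k, 0))), fun x => ?_⟩
        simp only [hq]
        rw [← Finset.mul_prod_erase _ _ (Finset.mem_univ k)]
        erw [hrest x]
        rw [Function.update_of_ne (h0 _)]
        simp [hinj]
        ring
  { toFun := fun v => a (v 0) * ∏ i : Fin n, β (v (pairIdx (i, 0))) (v (pairIdx (i, 1)))
    map_update_add' := by
      intro inst v j x y
      rw [Subsingleton.elim inst (instDecidableEqFin _)]
      obtain ⟨L, hL⟩ := key v j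
      simp only [hL, map_add]
    map_update_smul' := by
      intro inst v j c x
      rw [Subsingleton.elim inst (instDecidableEqFin _)]
      obtain ⟨L, hL⟩ := key v j
      simp only [hL, map_smul] }

/-- `a ∧ β^n` as an alternating form. -/
def wedgeAlternating (n : ℕ) (a : V →ₗ[ℝ] ℝ) (β : V →ₗ[ℝ] V →ₗ[ℝ] ℝ) :
    V [⋀^Fin (2 * n + 1)]→ₗ[ℝ] ℝ :=
  (1 / 2 ^ n : ℝ) • MultilinearMap.alternatization (wedgeMultilinear n a β)

lemma wedgeAlternating_apply (n : ℕ) (a : V →ₗ[ℝ] ℝ) (β : V →ₗ[ℝ] V →ₗ[ℝ] ℝ)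
    (v : Fin (2 * n + 1) → V) :
    wedgeAlternating n a β v = wedgePow n a (fun x y => β x y) v := by
  simp only [wedgeAlternating, wedgePow, AlternatingMap.smul_apply,
    MultilinearMap.alternatization_apply, smul_eq_mul]
  congr 1
  refine Finset.sum_congr rfl fun σ _ => ?_
  rw [mul_assoc, Units.smul_def, zsmul_eq_mul]
  rfl

end WedgePow

/-! ### Frames of tamed complex vector spaces. -/

section Linear

variable {V : Type*} [AddCommGroup V] [Module ℝ V]

/-- An alternating form killed by insertion of `Z` descends to the quotient by `Z`: change the
entries one at a time. -/
lemma alternatingMap_congr_of_sub_mem {m : ℕ} (Ψ : V [⋀^Fin m]→ₗ[ℝ] ℝ) (Z : Submodule ℝ V)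
    (hZ : ∀ z ∈ Z, ∀ (u : Fin m → V) (j : Fin m), Ψ (Function.update u j z) = 0)
    (v v' : Fin m → V) (h : ∀ j, v j - v' j ∈ Z) : Ψ v = Ψ v' := by
  suffices ∀ S : Finset (Fin m), Ψ (S.piecewise v v') = Ψ v' by simpa using this Finset.univ
  intro S
  induction S using Finset.induction_on with
  | empty => simp
  | insert j S hj ih =>
    rw [Finset.piecewise_insert, ← sub_add_cancel (v j) (v' j), AlternatingMap.map_update_add,
      hZ _ (h j), zero_add, ← ih]
    congr 1
    rw [Function.update_eq_self_iff, Finset.piecewise_eq_of_notMem _ _ _ hj]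

/-- A tamed complex vector space has a complex frame which is carried by a volume-preserving change
of frame (up to a positive factor) to a symplectic one. -/
lemma exists_tame_frame (n : ℕ) : ∀ {V : Type*} [AddCommGroup V] [Module ℝ V]
    [FiniteDimensional ℝ V], Module.finrank ℝ V = 2 * n → ∀ (J : V →ₗ[ℝ] V)
    (_ : ∀ v, J (J v) = -v) (β : V →ₗ[ℝ] V →ₗ[ℝ] ℝ) (_ : ∀ v w, β v w = -β w v)
    (_ : ∀ v, v ≠ 0 → 0 < β v (J v)), ∃ b s : Fin (2 * n) → V,
      (∀ i : Fin n, b ⟨2 * i + 1, by omega⟩ = J (b ⟨2 * i, by omega⟩)) ∧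
      (∀ i : Fin n, 0 < β (s ⟨2 * i, by omega⟩) (s ⟨2 * i + 1, by omega⟩)) ∧
      (∀ j k : Fin (2 * n), (j : ℕ) / 2 ≠ (k : ℕ) / 2 → β (s j) (s k) = 0) ∧
      ∀ Θ : V [⋀^Fin (2 * n)]→ₗ[ℝ] ℝ, 0 < Θ s → 0 < Θ b := by
  induction n with
  | zero =>
    intro V _ _ _ _ J _ β _ _
    exact ⟨fun j => j.elim0, fun j => j.elim0, fun i => i.elim0, fun i => i.elim0,
      fun j => j.elim0, fun Θ h => h⟩
  | succ n ih =>
    intro V _ _ _ hV J hJ β hβ ht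
    have : Nontrivial V := Module.nontrivial_of_finrank_pos (R := ℝ) (by omega)
    obtain ⟨e, he⟩ := exists_ne (0 : V)
    set f := J e with hf
    set c := β e f with hc
    have hc0 : 0 < c := ht e he
    have hself : ∀ v, β v v = 0 := fun v => by linarith [hβ v v]
    have hfe : β f e = -c := hβ f e
    have hJf : J f = -e := hJ e
    -- Induct on the `β`-orthogonal complement `W` of the complex line spanned by `e` and `f = Je`.
    -- In general `W` is not `J`-invariant, since `β` only tames `J`.
    let φ : V →ₗ[ℝ] ℝ × ℝ := (β e).prod (β f)
    let W := LinearMap.ker φ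
    have hW : ∀ w, w ∈ W ↔ β e w = 0 ∧ β f w = 0 := fun w => by
      simp [W, φ, LinearMap.mem_ker]
    have hφ : LinearMap.range φ = ⊤ := by
      rw [LinearMap.range_eq_top]
      rintro ⟨x, y⟩
      refine ⟨(x / c) • f - (y / c) • e, ?_⟩
      simp only [φ, LinearMap.prod_apply, Function.prod_apply, map_sub, map_smul, hself, hfe, ← hc]
      ext <;> simp [hc0.ne']
    have hWdim : Module.finrank ℝ W = 2 * n := by
      have := LinearMap.finrank_range_add_finrank_ker φ
      rw [hφ, finrank_top, Module.finrank_prod, Module.finrank_self, hV] at this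
      change 1 + 1 + Module.finrank ℝ W = _ at this
      omega
    -- The projection onto `W` along `span {e, f}`.
    let π₀ : V →ₗ[ℝ] V := LinearMap.id - (c⁻¹ • (β e).smulRight f) + c⁻¹ • (β f).smulRight e
    have hπ₀ : ∀ v, π₀ v = v - (c⁻¹ * β e v) • f + (c⁻¹ * β f v) • e := fun v => by
      simp [π₀, smul_smul]
    let π : V →ₗ[ℝ] W := π₀.codRestrict W fun v => by
      rw [hW, hπ₀]
      simp only [map_sub, map_add, map_smul, smul_eq_mul, hself, hfe, ← hc]
      constructor <;> field_simp <;> ring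
    have hπ : ∀ v, (π v : V) = v - (c⁻¹ * β e v) • f + (c⁻¹ * β f v) • e := hπ₀
    have hπW : ∀ w : W, π w = w := fun w => by
      ext
      rw [hπ, ((hW w).mp w.2).1, ((hW w).mp w.2).2]
      simp
    have hπe : π e = 0 := by
      ext
      rw [hπ, hself, hfe]
      simp [hc0.ne']
    have hπf : π f = 0 := by
      ext
      rw [hπ, hself, ← hc]
      simp [hc0.ne']
    -- The compression of `J` to `W`. It squares to `-1` because `span {e, f} = ker π` is
    -- `J`-invariant, and `β` tames it because `π` changes `J w` only by vectors `β`-orthogonal to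
    -- `w`.
    let J' : W →ₗ[ℝ] W := π ∘ₗ J ∘ₗ W.subtype
    have hJ'apply : ∀ w : W, J' w = π (J w) := fun _ => rfl
    obtain ⟨b', s', hb', hs', hs'', hΘ'⟩ := ih hWdim J' (fun w => by
        rw [hJ'apply, hJ'apply, hπ]
        simp only [map_add, map_sub, map_smul, hJ, hJf, ← hf, map_neg, hπW, hπe, hπf]
        simp) ((β.domRestrict W).flip.domRestrict W).flip (fun v w => hβ v w) (fun w hw => by
        have h1 := ht w (by simpa using hw)
        have hw' := (hW w).mp w.2
        change 0 < β w (π (J w))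
        rw [hπ]
        simp only [map_add, map_sub, map_smul, hβ w e, hβ w f, hw']
        simpa using h1)
    -- The frame `b'` is complex for `J'` only. Keeping its even vectors and replacing the odd ones
    -- by their true `J`-images gives a frame complex for `J` and congruent to `b'` modulo `span {e,
    -- f}`.
    let b'' : Fin (2 * n) → V := fun j =>
      if (j : ℕ) % 2 = 0 then (b' j : V) else J (b' ⟨(j : ℕ) - 1, by omega⟩)
    have hb'' : ∀ j, π (b'' j) = b' j := by
      intro j
      by_cases hj : (j : ℕ) % 2 = 0
      · simp only [b'', hj, if_true, hπW]
      · have h1 := hb' ⟨(j : ℕ) / 2, by omega⟩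
        have e1 : (⟨2 * ((j : ℕ) / 2) + 1, by omega⟩ : Fin (2 * n)) = j := Fin.ext (by simp only; omega)
        have e2 : (⟨2 * ((j : ℕ) / 2), by omega⟩ : Fin (2 * n)) = ⟨(j : ℕ) - 1, by omega⟩ :=
          Fin.ext (by simp only; omega)
        simp only [e1, e2] at h1
        simp only [b'', hj, if_false, h1, hJ'apply]
    refine ⟨(Fin.cons e (Fin.cons f b'' : Fin (2 * n + 1) → V) : Fin (2 * n + 1 + 1) → V),
      (Fin.cons e (Fin.cons f (fun j => (s' j : V)) : Fin (2 * n + 1) → V) :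
        Fin (2 * n + 1 + 1) → V), ?_, ?_, ?_, ?_⟩
    · intro i
      refine Fin.cases rfl (fun i => ?_) i
      change b'' ⟨2 * i + 1, by omega⟩ = J (b'' ⟨2 * i, by omega⟩)
      have h1 : (2 * (i : ℕ) + 1) % 2 ≠ 0 := by omega
      have h2 : (2 * (i : ℕ)) % 2 = 0 := by omega
      simp only [b'', h1, h2, if_true, if_false]
      rfl
    · intro i
      refine Fin.cases hc0 (fun i => ?_) i
      exact hs' i
    · have hes : ∀ j, β e (s' j) = 0 := fun j => ((hW _).mp (s' j).2).1
      have hfs : ∀ j, β f (s' j) = 0 := fun j => ((hW _).mp (s' j).2).2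
      have hcase : ∀ j : Fin (2 * n + 1 + 1), j = 0 ∨ j = Fin.succ 0 ∨
          ∃ i : Fin (2 * n), j = i.succ.succ := fun j => by
        refine Fin.cases (Or.inl rfl) (fun j => Or.inr ?_) j
        exact Fin.cases (Or.inl rfl) (fun j => Or.inr ⟨j, rfl⟩) j
      intro j k h
      rcases hcase j with rfl | rfl | ⟨j, rfl⟩ <;> rcases hcase k with rfl | rfl | ⟨k, rfl⟩
      · exact absurd rfl h
      · exact absurd (by rw [Fin.val_succ, Fin.val_zero, Fin.val_zero]) h
      · exact hes k
      · exact absurd (by rw [Fin.val_succ, Fin.val_zero, Fin.val_zero]) h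
      · exact absurd rfl h
      · exact hfs k
      · exact (hβ _ _).trans (by rw [neg_eq_zero]; exact hes j)
      · exact (hβ _ _).trans (by rw [neg_eq_zero]; exact hfs j)
      · refine hs'' j k fun h' => h ?_
        simp only [Fin.val_succ]
        omega
    · intro Θ
      let Θ₁ : V [⋀^Fin (2 * n + 1 + 1)]→ₗ[ℝ] ℝ := Θ
      -- After inserting `e` and `f`, the form no longer sees `span {e, f}`, so `b''` may be
      -- exchanged for `b'`, to which the induction hypothesis applies.
      let Ψ : V [⋀^Fin (2 * n)]→ₗ[ℝ] ℝ := (Θ₁.curryLeft e).curryLeft f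
      have hΨ : ∀ v : Fin (2 * n) → V, Ψ v = Θ₁ (Fin.cons e (Fin.cons f v)) := fun v => rfl
      have hkey := alternatingMap_congr_of_sub_mem Ψ (Submodule.span ℝ {e, f}) (by
        intro z hz u j
        obtain ⟨x, y, rfl⟩ := Submodule.mem_span_pair.mp hz
        rw [AlternatingMap.map_update_add, AlternatingMap.map_update_smul,
          AlternatingMap.map_update_smul, hΨ, hΨ]
        rw [Θ₁.map_eq_zero_of_eq (i := 0) (j := j.succ.succ) _ (by simp) (Fin.succ_ne_zero _).symm,
          Θ₁.map_eq_zero_of_eq (i := Fin.succ 0) (j := j.succ.succ) _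
            (by simp only [Fin.cons_succ, Fin.cons_zero, Function.update_self])
            (fun h => (Fin.succ_ne_zero j).symm (Fin.succ_injective _ h))]
        simp) b'' (fun j => (b' j : V)) (fun j => by
          rw [← hb'', hπ, Submodule.mem_span_pair]
          exact ⟨-(c⁻¹ * β f (b'' j)), c⁻¹ * β e (b'' j), by module⟩)
      intro h
      change 0 < Ψ b''
      rw [hkey]
      exact hΘ' (Ψ.compLinearMap W.subtype) h

/-- The change of frame commutes with `J`, so it is `ℂ`-linear, and its real determinant is the
squared modulus of its nonzero complex determinant. -/
lemma det_pos_of_complex_frames {m : ℕ} (J : V →ₗ[ℝ] V) (hJ : ∀ v, J (J v) = -v)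
    (b b' : Module.Basis (Fin (2 * m)) ℝ V)
    (hb : ∀ i : Fin m, b ⟨2 * i + 1, by omega⟩ = J (b ⟨2 * i, by omega⟩))
    (hb' : ∀ i : Fin m, b' ⟨2 * i + 1, by omega⟩ = J (b' ⟨2 * i, by omega⟩)) :
    0 < b.det b' := by
  let f : ℂ →ₐ[ℝ] Module.End ℝ V := Complex.lift ⟨J, by ext v; simpa using hJ v⟩
  let _ : Module ℂ V := Module.compHom V f.toRingHom
  have hsmul : ∀ (z : ℂ) (v : V), z • v = z.re • v + z.im • J v := fun z v => by
    change f z v = _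
    simp [f, Complex.liftAux_apply, Module.algebraMap_end_apply]
  have : IsScalarTower ℝ ℂ V := ⟨fun r z v => by simp [hsmul, smul_smul]⟩
  let T : V ≃ₗ[ℝ] V := b.equiv b' (Equiv.refl _)
  have hTb : ∀ i, T (b i) = b' i := fun i => by simp [T]
  have hTJ : ∀ v, T (J v) = J (T v) := by
    intro v
    have : T.toLinearMap ∘ₗ J = J ∘ₗ T.toLinearMap := by
      refine b.ext fun j => ?_
      simp only [LinearMap.comp_apply, LinearEquiv.coe_coe]
      rcases Nat.even_or_odd' (j : ℕ) with ⟨k, hk | hk⟩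
      · have e0 : j = ⟨2 * ((⟨k, by omega⟩ : Fin m) : ℕ), by simp only; omega⟩ := Fin.ext hk
        rw [e0, ← hb, hTb, hTb, hb']
      · have e1 : j = ⟨2 * ((⟨k, by omega⟩ : Fin m) : ℕ) + 1, by simp only; omega⟩ := Fin.ext hk
        rw [e1, hb, hJ, map_neg, hTb, ← hb, hTb, hb', hJ]
    exact LinearMap.congr_fun this v
  let TC : V ≃ₗ[ℂ] V := { T with map_smul' := fun z v => by simp [hsmul, hTJ] }
  have h1 : LinearMap.det T.toLinearMap = Algebra.norm ℝ (LinearMap.det TC.toLinearMap) :=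
    LinearMap.det_restrictScalars (f := TC.toLinearMap)
  have h2 : b.det b' = LinearMap.det T.toLinearMap := by
    have := b.det_comp T.toLinearMap b
    rw [b.det_self, mul_one] at this
    rw [← this]
    congr 1
    ext i
    simp [hTb]
  rw [h2, h1, Algebra.norm_complex_apply, Complex.normSq_pos]
  exact (LinearEquiv.isUnit_det' TC).ne_zero

end Linear

/-! ### Real hyperplanes in a complex vector space. -/

section LinearModel

variable {U V : Type*} [AddCommGroup U] [Module ℝ U] [FiniteDimensional ℝ U]
  [AddCommGroup V] [Module ℝ V] [FiniteDimensional ℝ V]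

omit [FiniteDimensional ℝ V] in
lemma range_eq_ker_of_finrank {m : ℕ} (hU : Module.finrank ℝ U = m + 1)
    (hV : Module.finrank ℝ V = m) (P : V →ₗ[ℝ] U) (hP : Function.Injective P) (l : U →ₗ[ℝ] ℝ)
    (hl : l ≠ 0) (hlP : ∀ v, l (P v) = 0) : LinearMap.range P = LinearMap.ker l := by
  refine Submodule.eq_of_le_of_finrank_eq ?_ ?_
  · rintro _ ⟨v, rfl⟩
    exact hlP v
  · have h1 := Module.Dual.finrank_ker_add_one_of_ne_zero (f := l) hl
    rw [LinearMap.finrank_range_of_inj hP]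
    omega

/-- A real hyperplane `P(V) = ker l` in a complex vector space `(U, J)`, the linear form `-l ∘ J ∘ P`
on it and a bilinear form taming `J` on its complex tangencies: adapted frames. -/
lemma exists_adapted_frames {n : ℕ} (hU : Module.finrank ℝ U = 2 * n + 2)
    (hV : Module.finrank ℝ V = 2 * n + 1) (J : U →ₗ[ℝ] U) (hJ : ∀ u, J (J u) = -u)
    (P : V →ₗ[ℝ] U) (hP : Function.Injective P) (l : U →ₗ[ℝ] ℝ) (hl : l ≠ 0)
    (hlP : ∀ v, l (P v) = 0) (a : V →ₗ[ℝ] ℝ) (ha : ∀ v, a v = -l (J (P v)))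
    (β : V →ₗ[ℝ] V →ₗ[ℝ] ℝ) (hβ : ∀ v w, β v w = -β w v)
    (ht : ∀ v w, a v = 0 → v ≠ 0 → P w = J (P v) → 0 < β v w) :
    ∃ (eV : Module.Basis (Fin (2 * n + 1)) ℝ V) (eU : Module.Basis (Fin (2 * n + 2)) ℝ U),
      0 < wedgePow n a (fun x y => β x y) eV ∧ 0 < l (eU 0) ∧
      (⇑eU : Fin (2 * n + 2) → U) = Fin.cons (eU 0) (fun i => P (eV i)) ∧
      ∀ i : Fin (n + 1), eU ⟨2 * i + 1, by omega⟩ = J (eU ⟨2 * i, by omega⟩) := by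
  have hrange := range_eq_ker_of_finrank hU hV P hP l hl hlP
  -- Otherwise `ker l` is `J`-invariant and `J` acts on the one-dimensional quotient by a real
  -- number `l (J u) / l u` with square `-1`.
  have ha0 : a ≠ 0 := by
    intro h0
    obtain ⟨u, hu⟩ : ∃ u, l u ≠ 0 := by
      by_contra! h
      exact hl (LinearMap.ext h)
    have hker : ∀ w, l w = 0 → l (J w) = 0 := by
      intro w hw
      obtain ⟨v, rfl⟩ : w ∈ LinearMap.range P := by rw [hrange]; exact hw
      have := ha v
      rw [h0, LinearMap.zero_apply] at this
      linarith
    have h1 := hker (J u - (l (J u) / l u) • u) (by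
      rw [map_sub, map_smul, smul_eq_mul, div_mul_cancel₀ _ hu, sub_self])
    rw [map_sub, map_smul, hJ, map_sub, map_smul, map_neg, smul_eq_mul] at h1
    have h2 : l u * l u + l (J u) * l (J u) = 0 := by
      field_simp at h1
      linarith
    nlinarith [mul_self_pos.mpr hu, mul_self_nonneg (l (J u))]
  obtain ⟨R, hR⟩ : ∃ R, 0 < a R := by
    obtain ⟨v, hv⟩ : ∃ v, a v ≠ 0 := by
      by_contra! h
      exact ha0 (LinearMap.ext h)
    rcases lt_or_gt_of_ne hv with h | h
    · exact ⟨-v, by rw [map_neg]; linarith⟩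
    · exact ⟨v, h⟩
  let K := LinearMap.ker a
  have hK : Module.finrank ℝ K = 2 * n := by
    have : Module.finrank ℝ K + 1 = _ := Module.Dual.finrank_ker_add_one_of_ne_zero (f := a) ha0
    omega
  -- A left inverse of `P` transports `J` to the complex tangencies `K = ker a`, where `J (P v)`
  -- again lies in the range of `P`.
  obtain ⟨Q, hQ⟩ := P.exists_leftInverse_of_injective (LinearMap.ker_eq_bot.mpr hP)
  have hQP : ∀ v, Q (P v) = v := fun v => LinearMap.congr_fun hQ v
  have hPQ : ∀ v, a v = 0 → P (Q (J (P v))) = J (P v) := by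
    intro v hv
    obtain ⟨w, hw⟩ : J (P v) ∈ LinearMap.range P := by
      rw [hrange, LinearMap.mem_ker]
      linarith [ha v]
    rw [← hw, hQP]
  let JK : K →ₗ[ℝ] K := (Q ∘ₗ J ∘ₗ P ∘ₗ K.subtype).codRestrict K fun v => by
    rw [LinearMap.mem_ker, ha]
    simp only [LinearMap.comp_apply, Submodule.subtype_apply]
    rw [hPQ v v.2, hJ, map_neg, hlP]
    simp
  have hPJK : ∀ v : K, P (JK v) = J (P v) := fun v => hPQ v v.2
  obtain ⟨b, s, hb, hs, hs', hΘ⟩ := exists_tame_frame n hK JK (fun v => by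
      apply Subtype.ext
      apply hP
      rw [hPJK, hPJK, hJ]
      simp) (β.compl₁₂ K.subtype K.subtype) (fun v w => hβ v w) (fun v hv =>
      ht v (JK v) v.2 (by simpa using hv) (hPJK v))
  have hs0 : 0 < wedgePow n a (fun x y => β x y)
      (Fin.cons R (fun j => (s j : V)) : Fin (2 * n + 1) → V) := by
    refine wedgePow_pos_of_symplectic _ _ hβ _ hR ?_ ?_ ?_
    · intro j
      refine Fin.cases (fun h => absurd rfl h) (fun j _ => (s j).2) j
    · exact fun i => hs i
    · rintro ⟨i, ε⟩ ⟨k, δ⟩ hik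
      have hidx : ∀ (i : Fin n) (ε : Fin 2),
          pairIdx (i, ε) = Fin.succ (⟨2 * i + ε, by omega⟩ : Fin (2 * n)) := fun i ε =>
        Fin.ext (by simp only [pairIdx, Fin.val_succ]; omega)
      rw [hidx, hidx, Fin.cons_succ, Fin.cons_succ]
      refine hs' ⟨2 * i + ε, by omega⟩ ⟨2 * k + δ, by omega⟩ ?_
      simp only [ne_eq, Fin.ext_iff] at hik ⊢
      omega
  let vb : Fin (2 * n + 1) → V := Fin.cons R (fun j => (b j : V))
  -- Contract `a ∧ β^n` with `R` and restrict to `K`: positivity passes from the symplectic frame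
  -- `s` to the complex frame `b`.
  have hb0 : 0 < wedgeAlternating n a β vb :=
    hΘ (((wedgeAlternating n a β).curryLeft R).compLinearMap K.subtype)
      (by
        change 0 < wedgeAlternating n a β _
        rw [wedgeAlternating_apply]
        exact hs0)
  have hli : LinearIndependent ℝ vb := by
    by_contra h
    exact hb0.ne' ((wedgeAlternating n a β).map_linearDependent vb h)
  let eV : Module.Basis (Fin (2 * n + 1)) ℝ V :=
    basisOfLinearIndependentOfCardEqFinrank hli (by simp [hV])
  have heV : ⇑eV = vb := coe_basisOfLinearIndependentOfCardEqFinrank _ _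
  -- The vector `-J (P R)` has `l`-value `a R > 0`, and `J` sends it to `P R`. Hence it completes `P
  -- R` and the complex frame of `K` to a complex frame of `U`.
  have hliU : LinearIndependent ℝ
      (Fin.cons (-J (P R)) (fun i => P (vb i)) : Fin (2 * n + 2) → U) := by
    rw [linearIndependent_finCons]
    refine ⟨hli.map' P (LinearMap.ker_eq_bot.mpr hP), fun hmem => ?_⟩
    have h1 : Submodule.span ℝ (Set.range fun i => P (vb i)) ≤ LinearMap.ker l := by
      rw [Submodule.span_le]
      rintro _ ⟨i, rfl⟩
      exact hlP _
    have h2 : l (-J (P R)) = 0 := h1 hmem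
    rw [map_neg, ← ha] at h2
    exact hR.ne' h2
  let eU : Module.Basis (Fin (2 * n + 2)) ℝ U :=
    basisOfLinearIndependentOfCardEqFinrank hliU (by simp [hU])
  have heU : ⇑eU = Fin.cons (-J (P R)) (fun i => P (vb i)) :=
    coe_basisOfLinearIndependentOfCardEqFinrank _ _
  have heU0 : eU 0 = -J (P R) := by rw [heU]; rfl
  refine ⟨eV, eU, ?_, ?_, ?_, ?_⟩
  · rw [← wedgeAlternating_apply, heV]
    exact hb0
  · rw [heU0, map_neg, ← ha]
    exact hR
  · rw [heU0, heU, heV]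
  · rw [heU]
    intro i
    refine Fin.cases ?_ (fun i => ?_) i
    · change P R = J (-J (P R))
      rw [map_neg, hJ, neg_neg]
    · change P (b ⟨2 * i + 1, by omega⟩) = J (P (b ⟨2 * i, by omega⟩))
      rw [hb, hPJK]

/-- Positivity of `a ∧ β^n` on frames of the hyperplane which are positive for the boundary
orientation. -/
lemma wedgePow_pos_of_isJPositive {n : ℕ} (hU : Module.finrank ℝ U = 2 * n + 2)
    (hV : Module.finrank ℝ V = 2 * n + 1) (J : U →ₗ[ℝ] U) (hJ : ∀ u, J (J u) = -u)
    (P : V →ₗ[ℝ] U) (hP : Function.Injective P) (l : U →ₗ[ℝ] ℝ)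
    (hlP : ∀ v, l (P v) = 0) (a : V →ₗ[ℝ] ℝ) (ha : ∀ v, a v = -l (J (P v)))
    (β : V →ₗ[ℝ] V →ₗ[ℝ] ℝ) (hβ : ∀ v w, β v w = -β w v)
    (ht : ∀ v w, a v = 0 → v ≠ 0 → P w = J (P v) → 0 < β v w)
    (Y : U) (hY : 0 < l Y) (v : Fin (2 * n + 1) → V)
    (hv : IsJPositive (n := n) J (Fin.cons Y fun i => P (v i))) :
    0 < wedgePow n a (fun x y => β x y) v := by
  have hl : l ≠ 0 := by
    rintro rfl
    simp at hY
  have hrange := range_eq_ker_of_finrank hU hV P hP l hl hlP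
  obtain ⟨eV, eU, hpos, hl0, heU, hpair⟩ := exists_adapted_frames hU hV J hJ P hP l hl hlP a ha β hβ ht
  obtain ⟨b, hb, hdet⟩ := hv
  have h1 : 0 < eU.det b := det_pos_of_complex_frames (m := n + 1) J hJ eU b hpair hb
  have h2 : 0 < eU.det (Fin.cons Y fun i => P (v i)) := by
    rw [AlternatingMap.eq_smul_basis_det b eU.det]
    exact mul_pos h1 hdet
  -- The volume form of `U` contracted with `y` and pulled back to `V`. Writing `Y = t • eU 0 + P z`
  -- with `t > 0`, the part `P z` is tangent to the hyperplane and contributes nothing, so `Ξ Y = t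
  -- • eV.det`. A frame positive for the boundary orientation is therefore positive relative to
  -- `eV`.
  let Ξ : U → V [⋀^Fin (2 * n + 1)]→ₗ[ℝ] ℝ := fun y =>
    (AlternatingMap.curryLeft (n := 2 * n + 1) eU.det y).compLinearMap P
  have hΞ : ∀ y w, Ξ y w = eU.det (Fin.cons y fun i => P (w i)) := fun y w => rfl
  set t := l Y / l (eU 0) with ht'
  have htpos : 0 < t := div_pos hY hl0
  obtain ⟨z, hz⟩ : Y - t • eU 0 ∈ LinearMap.range P := by
    rw [hrange, LinearMap.mem_ker, map_sub, map_smul, smul_eq_mul, ht', div_mul_cancel₀ _ hl0.ne',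
      sub_self]
  have hYz : Y = t • eU 0 + P z := by rw [hz]; abel
  have hz0 : Ξ (P z) eV = 0 := by
    rw [hΞ]
    refine AlternatingMap.map_linearDependent _ _ fun hli => ?_
    have : (Fin.cons (P z) (fun i => P (eV i)) : Fin (2 * n + 2) → U) =
        P ∘ (Fin.cons z eV : Fin (2 * n + 2) → V) := by
      ext1 i
      refine Fin.cases rfl (fun i => rfl) i
    rw [this] at hli
    have h3 := hli.of_comp.fintype_card_le_finrank
    rw [hV, Fintype.card_fin] at h3
    omega
  have h0 : Ξ (eU 0) eV = 1 := by
    rw [hΞ, ← heU, eU.det_self]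
  have hΞV : Ξ Y eV = t := by
    have : Ξ Y = t • Ξ (eU 0) + Ξ (P z) := by
      ext w
      simp only [Ξ, hYz, map_add, map_smul]
      rfl
    rw [this]
    simp [h0, hz0]
  have h3 : Ξ Y v = t * eV.det v := by
    rw [AlternatingMap.eq_smul_basis_det eV (Ξ Y), hΞV]
    rfl
  have h4 : 0 < eV.det v := by
    rw [← hΞ, h3] at h2
    exact pos_of_mul_pos_right h2 htpos.le
  rw [← wedgeAlternating_apply, AlternatingMap.eq_smul_basis_det eV (wedgeAlternating n a β)]
  rw [← wedgeAlternating_apply] at hpos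
  exact mul_pos hpos h4

end LinearModel

/-! ### Calculus of exterior derivatives of one-forms on subsets of a vector space. -/

section Curl

open Filter Topology Set

variable {E F : Type*} [NormedAddCommGroup E] [NormedSpace ℝ E]
  [NormedAddCommGroup F] [NormedSpace ℝ F]

/-- The exterior derivative of a `1`-form on a subset of a vector space, on two vectors. -/
def curlWithin (a : E → E →L[ℝ] ℝ) (S : Set E) (y v w : E) : ℝ :=
  fderivWithin ℝ a S y v w - fderivWithin ℝ a S y w v

lemma extDerivWithin_ofSubsingleton (a : E → E →L[ℝ] ℝ) {S : Set E} {y : E}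
    (hS : UniqueDiffWithinAt ℝ S y) (v w : E) :
    extDerivWithin (fun y => ContinuousAlternatingMap.ofSubsingleton ℝ E ℝ (0 : Fin 1) (a y)) S y
      ![v, w] = curlWithin a S y v w := by
  let L : (E →L[ℝ] ℝ) ≃ₗᵢ[ℝ] E [⋀^Fin 1]→L[ℝ] ℝ :=
    ContinuousAlternatingMap.ofSubsingletonLIE (0 : Fin 1)
  have h : fderivWithin ℝ (fun y => ContinuousAlternatingMap.ofSubsingleton ℝ E ℝ (0 : Fin 1) (a y))
      S y = (L.toContinuousLinearEquiv : (E →L[ℝ] ℝ) →L[ℝ] E [⋀^Fin 1]→L[ℝ] ℝ).comp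
        (fderivWithin ℝ a S y) :=
    L.toContinuousLinearEquiv.comp_fderivWithin hS
  rw [extDerivWithin, h, ContinuousAlternatingMap.alternatizeUncurryFin_apply, Fin.sum_univ_two,
    curlWithin]
  simp [L, Fin.removeNth, sub_eq_add_neg]

/-- The second derivative of `f` drops out by symmetry; on a set with boundary this symmetry is
guaranteed at limits of interior points, whence `hyc`. -/
lemma curlWithin_pullback {a : F → F →L[ℝ] ℝ} {f : E → F} {S : Set E} {T : Set F} {y : E}
    (ha : DifferentiableWithinAt ℝ a T (f y)) (hf : ContDiffWithinAt ℝ ∞ f S y)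
    (hS : UniqueDiffOn ℝ S) (hT : UniqueDiffWithinAt ℝ T (f y)) (hyc : y ∈ closure (interior S))
    (hy : y ∈ S) (hST : MapsTo f S T) (v w : E) :
    curlWithin (fun z => (a (f z)).comp (fderivWithin ℝ f S z)) S y v w =
      curlWithin a T (f y) (fderivWithin ℝ f S y v) (fderivWithin ℝ f S y w) := by
  let L : (F →L[ℝ] ℝ) ≃ₗᵢ[ℝ] F [⋀^Fin 1]→L[ℝ] ℝ :=
    ContinuousAlternatingMap.ofSubsingletonLIE (0 : Fin 1)
  rw [← extDerivWithin_ofSubsingleton _ (hS y hy), ← extDerivWithin_ofSubsingleton _ hT]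
  have ha' : DifferentiableWithinAt ℝ
      (fun z => ContinuousAlternatingMap.ofSubsingleton ℝ F ℝ (0 : Fin 1) (a z)) T (f y) :=
    L.toContinuousLinearEquiv.differentiable.differentiableAt.comp_differentiableWithinAt _ ha
  have h := extDerivWithin_pullback ha' hf (by rw [minSmoothness_of_isRCLikeNormedField]; exact WithTop.coe_le_coe.mpr le_top) hS hyc hy hST
  have h2 : (fun z => ContinuousAlternatingMap.ofSubsingleton ℝ E ℝ (0 : Fin 1)
      ((a (f z)).comp (fderivWithin ℝ f S z))) = fun z =>
      (ContinuousAlternatingMap.ofSubsingleton ℝ F ℝ (0 : Fin 1) (a (f z))).compContinuousLinearMap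
        (fderivWithin ℝ f S z) := rfl
  rw [h2, h, ContinuousAlternatingMap.compContinuousLinearMap_apply]
  congr 1
  ext i
  fin_cases i <;> rfl

lemma curlWithin_congr {a b : E → E →L[ℝ] ℝ} {S : Set E} {y : E} (h : a =ᶠ[𝓝[S] y] b) (hy : y ∈ S)
    (v w : E) : curlWithin a S y v w = curlWithin b S y v w := by
  simp only [curlWithin, h.fderivWithin_eq_of_mem hy]

lemma curlWithin_add {a b : E → E →L[ℝ] ℝ} {S : Set E} {y : E} (hS : UniqueDiffWithinAt ℝ S y)
    (ha : DifferentiableWithinAt ℝ a S y) (hb : DifferentiableWithinAt ℝ b S y) (v w : E) :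
    curlWithin (fun z => a z + b z) S y v w = curlWithin a S y v w + curlWithin b S y v w := by
  simp only [curlWithin, fderivWithin_fun_add hS ha hb, add_apply]
  ring

lemma curlWithin_smul {f : E → ℝ} {a : E → E →L[ℝ] ℝ} {S : Set E} {y : E}
    (hS : UniqueDiffWithinAt ℝ S y) (hf : DifferentiableWithinAt ℝ f S y)
    (ha : DifferentiableWithinAt ℝ a S y) (v w : E) :
    curlWithin (fun z => f z • a z) S y v w = f y * curlWithin a S y v w +
      (fderivWithin ℝ f S y v * a y w - fderivWithin ℝ f S y w * a y v) := by
  simp only [curlWithin, fderivWithin_fun_smul hS hf ha, add_apply,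
    smul_apply, ContinuousLinearMap.smulRight_apply, smul_eq_mul]
  ring

end Curl

/-! ### One-forms on manifolds in charts, and their pull-backs. -/

section OneFormCharts

open Filter Topology Set

variable {E : Type*} [NormedAddCommGroup E] [NormedSpace ℝ E] {H : Type*} [TopologicalSpace H]
  {I : ModelWithCorners ℝ E H} {X : Type*} [TopologicalSpace X] [ChartedSpace H X]

lemma extDerivOneForm_eq_curlWithin (α : (x : X) → TangentSpace I x →L[ℝ] ℝ) (x : X)
    (v w : TangentSpace I x) : extDerivOneForm I α x v w =
      curlWithin (oneFormInChart I α x) (range I) (extChartAt I x x) v w :=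
  extDerivWithin_ofSubsingleton _ (I.uniqueDiffOn _ (mem_range_self _)) _ _

variable [IsManifold I ∞ X]

omit [IsManifold I ∞ X] in
lemma oneFormInChart_extChartAt (α : (x : X) → TangentSpace I x →L[ℝ] ℝ) {x z : X}
    (hz : z ∈ (chartAt H x).source) : oneFormInChart I α x (extChartAt I x z) =
      (α z).comp (mfderivWithin 𝓘(ℝ, E) I (extChartAt I x).symm (range I) (extChartAt I x z)) := by
  have hz' : (extChartAt I x).symm (extChartAt I x z) = z :=
    (extChartAt I x).left_inv (by rwa [extChartAt_source])
  have hα : ∀ p, p = z → (α p : E →L[ℝ] ℝ) = α z := by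
    rintro p rfl
    rfl
  ext v
  change (α ((extChartAt I x).symm (extChartAt I x z)) : E →L[ℝ] ℝ) _ = (α z : E →L[ℝ] ℝ) _
  rw [hα _ hz']
  rfl

/-- The trivialization of the cotangent bundle at `x` is the one induced by the preferred chart at
`x`. -/
lemma isSmoothOneForm_iff (α : (x : X) → TangentSpace I x →L[ℝ] ℝ) :
    IsSmoothOneForm I α ↔
      ∀ x, ContDiffWithinAt ℝ ∞ (oneFormInChart I α x) (range I) (extChartAt I x x) := by
  have : IsManifold I 1 X := .of_le (n := ∞) (by exact_mod_cast le_top)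
  refine forall_congr' fun x => ?_
  rw [contMDiffAt_hom_bundle]
  have heq : (fun z => ContinuousLinearMap.inCoordinates E (TangentSpace I (M := X)) ℝ
      (Bundle.Trivial X ℝ) x z x z (α z)) =ᶠ[𝓝 x]
      fun z => oneFormInChart I α x (extChartAt I x z) := by
    filter_upwards [chart_source_mem_nhds H x] with z hz
    have h1 : ∀ t : ℝ, (trivializationAt ℝ (Bundle.Trivial X ℝ) x).continuousLinearMapAt ℝ z t = t :=
      fun t => congrArg (fun L : ℝ →L[ℝ] ℝ => L t)
        (Bundle.Trivial.continuousLinearMapAt_trivialization ℝ X ℝ z)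
    refine ContinuousLinearMap.ext fun v => ?_
    refine Eq.trans ?_ (congrArg (fun L : E →L[ℝ] ℝ => L v) (oneFormInChart_extChartAt α hz)).symm
    refine (h1 _).trans ?_
    exact congrArg (α z) (DFunLike.congr_fun
      (TangentBundle.symmL_trivializationAt (𝕜 := ℝ) (I := I) hz) v)
  constructor
  · rintro ⟨_, h⟩
    have h' := (contMDiffAt_iff.mp (h.congr_of_eventuallyEq heq.symm)).2
    refine h'.congr_of_eventuallyEq_of_mem ?_ (mem_range_self _)
    filter_upwards [extChartAt_target_mem_nhdsWithin x] with y hy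
    change _ = oneFormInChart I α x (extChartAt I x ((extChartAt I x).symm y))
    rw [(extChartAt I x).right_inv hy]
  · intro h
    refine ⟨contMDiffAt_id, ContMDiffAt.congr_of_eventuallyEq ?_ heq⟩
    have := ContMDiffWithinAt.comp x h.contMDiffWithinAt
      (contMDiffAt_extChartAt (I := I) (n := ∞) (x := x)).contMDiffWithinAt (s := univ)
      (fun z _ => mem_range_self _)
    exact this

variable {E' : Type*} [NormedAddCommGroup E'] [NormedSpace ℝ E'] {H' : Type*} [TopologicalSpace H']
  {I' : ModelWithCorners ℝ E' H'} {Y : Type*} [TopologicalSpace Y] [ChartedSpace H' Y]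
  [IsManifold I' ∞ Y]

/-- The pull-back of a `1`-form. -/
def pullbackOneForm (I : ModelWithCorners ℝ E H) (f : X → Y)
    (α : (y : Y) → TangentSpace I' y →L[ℝ] ℝ) (x : X) : TangentSpace I x →L[ℝ] ℝ :=
  (α (f x)).comp (mfderiv I I' f x)

omit [IsManifold I ∞ X] in
lemma contDiffWithinAt_extChartAt_comp {f : X → Y} (hf : ContMDiff I I' ∞ f) {x : X} {y₀ : Y}
    (hy₀ : f x ∈ (chartAt H' y₀).source) :
    ContDiffWithinAt ℝ ∞ (extChartAt I' y₀ ∘ f ∘ (extChartAt I x).symm) (range I)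
      (extChartAt I x x) := by
  have h := (contMDiffAt_extChartAt' (I := I') (n := ∞) hy₀).comp x (hf x)
  exact (contMDiffAt_iff.mp h).2

omit [IsManifold I ∞ X] in
lemma mfderiv_extChartAt_comp {f : X → Y} (hf : ContMDiff I I' ∞ f) {x : X} {y₀ : Y}
    (hy₀ : f x ∈ (chartAt H' y₀).source) :
    mfderiv I 𝓘(ℝ, E') (extChartAt I' y₀ ∘ f) x =
      fderivWithin ℝ (extChartAt I' y₀ ∘ f ∘ (extChartAt I x).symm) (range I)
        (extChartAt I x x) := by
  have h := (contMDiffAt_extChartAt' (I := I') (n := ∞) hy₀).comp x (hf x)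
  rw [(h.mdifferentiableAt (by simp)).mfderiv]
  rfl

/-- The chain rule, after inserting the identity `D(φ⁻¹) ∘ Dφ` of the target chart between `α` and
`df`. -/
lemma oneFormInChart_pullback {f : X → Y} (hf : ContMDiff I I' ∞ f)
    (α : (y : Y) → TangentSpace I' y →L[ℝ] ℝ) {x : X} {y₀ : Y}
    (hy₀ : f x ∈ (chartAt H' y₀).source) :
    oneFormInChart I (pullbackOneForm I f α) x =ᶠ[𝓝[range I] (extChartAt I x x)] fun y =>
      (oneFormInChart I' α y₀ ((extChartAt I' y₀ ∘ f ∘ (extChartAt I x).symm) y)).comp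
        (fderivWithin ℝ (extChartAt I' y₀ ∘ f ∘ (extChartAt I x).symm) (range I) y) := by
  have : IsManifold I 1 X := .of_le (n := ∞) (by exact_mod_cast le_top)
  have : IsManifold I' 1 Y := .of_le (n := ∞) (by exact_mod_cast le_top)
  have hsrc : ∀ᶠ y in 𝓝[range I] (extChartAt I x x),
      f ((extChartAt I x).symm y) ∈ (chartAt H' y₀).source := by
    have hc : ContinuousWithinAt (f ∘ (extChartAt I x).symm) (range I) (extChartAt I x x) :=
      hf.continuous.continuousAt.comp_continuousWithinAt
        (continuousAt_extChartAt_symm x).continuousWithinAt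
    refine hc.eventually ((chartAt H' y₀).open_source.mem_nhds ?_)
    simpa using hy₀
  filter_upwards [hsrc, extChartAt_target_mem_nhdsWithin x] with y hy hyt
  set z := (extChartAt I x).symm y with hz
  have hF : HasMFDerivWithinAt 𝓘(ℝ, E) 𝓘(ℝ, E') (extChartAt I' y₀ ∘ f ∘ (extChartAt I x).symm)
      (range I) y ((mfderiv I' 𝓘(ℝ, E') (extChartAt I' y₀) (f z)).comp
        ((mfderiv I I' f z).comp
          (mfderivWithin 𝓘(ℝ, E) I (extChartAt I x).symm (range I) y))) := by
    refine HasMFDerivAt.comp_hasMFDerivWithinAt y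
      ((mdifferentiableAt_extChartAt hy).hasMFDerivAt) ?_
    exact HasMFDerivAt.comp_hasMFDerivWithinAt y
      ((hf.mdifferentiable (by simp)) z).hasMFDerivAt
      (mdifferentiableWithinAt_extChartAt_symm hyt).hasMFDerivWithinAt
  let L : E →L[ℝ] E' := (mfderiv I' 𝓘(ℝ, E') (extChartAt I' y₀) (f z)).comp
    ((mfderiv I I' f z).comp (mfderivWithin 𝓘(ℝ, E) I (extChartAt I x).symm (range I) y))
  have hL : HasFDerivWithinAt (extChartAt I' y₀ ∘ f ∘ (extChartAt I x).symm) L (range I) y :=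
    hasMFDerivWithinAt_iff_hasFDerivWithinAt.mp hF
  have hF' := hL.fderivWithin (I.uniqueDiffOn y (extChartAt_target_subset_range x hyt))
  have h2 := mfderivWithin_extChartAt_symm_comp_mfderiv_extChartAt' (I := I') (x := y₀)
    (y := f z) (by rwa [extChartAt_source])
  refine ContinuousLinearMap.ext fun v => ?_
  refine Eq.trans ?_ (congrArg (fun L : E →L[ℝ] E' => oneFormInChart I' α y₀
    (extChartAt I' y₀ (f z)) (L v)) hF').symm
  refine Eq.trans ?_ (congrArg (fun L : E' →L[ℝ] ℝ => L _) (oneFormInChart_extChartAt α hy)).symm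
  exact congrArg (α (f z)) (congrArg (fun L => L ((mfderiv I I' f z)
    (mfderivWithin 𝓘(ℝ, E) I (extChartAt I x).symm (range I) y v))) h2).symm

lemma IsSmoothOneForm.pullback {f : X → Y} (hf : ContMDiff I I' ∞ f)
    {α : (y : Y) → TangentSpace I' y →L[ℝ] ℝ} (hα : IsSmoothOneForm I' α) :
    IsSmoothOneForm I (pullbackOneForm I f α) := by
  rw [isSmoothOneForm_iff] at hα ⊢
  intro x
  have hF := contDiffWithinAt_extChartAt_comp hf (mem_chart_source H' (f x))
  refine ContDiffWithinAt.congr_of_eventuallyEq_of_mem ?_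
    (oneFormInChart_pullback hf α (mem_chart_source H' (f x))) (mem_range_self _)
  have h1 := hF.fderivWithin_right (m := ∞) I.uniqueDiffOn (by simp) (mem_range_self _)
  have h2 : ContDiffWithinAt ℝ ∞ (oneFormInChart I' α (f x) ∘
      (extChartAt I' (f x) ∘ f ∘ (extChartAt I x).symm)) (range I) (extChartAt I x x) := by
    refine ContDiffWithinAt.comp _ (t := range I') ?_ hF (fun y _ => mem_range_self _)
    simpa using hα (f x)
  exact h2.clm_comp h1

/-- The target chart is centred at an arbitrary `y₀`, not at `f x`: with `f = id` this gives the
chart independence of the exterior derivative. -/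
lemma extDerivOneForm_pullback_chart {f : X → Y} (hf : ContMDiff I I' ∞ f)
    {α : (y : Y) → TangentSpace I' y →L[ℝ] ℝ} {x : X} {y₀ : Y}
    (hy₀ : f x ∈ (chartAt H' y₀).source)
    (hα : DifferentiableWithinAt ℝ (oneFormInChart I' α y₀) (range I') (extChartAt I' y₀ (f x)))
    (v w : TangentSpace I x) :
    extDerivOneForm I (pullbackOneForm I f α) x v w =
      curlWithin (oneFormInChart I' α y₀) (range I') (extChartAt I' y₀ (f x))
        (mfderiv I' 𝓘(ℝ, E') (extChartAt I' y₀) (f x) (mfderiv I I' f x v))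
        (mfderiv I' 𝓘(ℝ, E') (extChartAt I' y₀) (f x) (mfderiv I I' f x w)) := by
  have : IsManifold I 1 X := .of_le (n := ∞) (by exact_mod_cast le_top)
  have : IsManifold I' 1 Y := .of_le (n := ∞) (by exact_mod_cast le_top)
  have hx : (extChartAt I' y₀ ∘ f ∘ (extChartAt I x).symm) (extChartAt I x x) =
      extChartAt I' y₀ (f x) := by simp
  rw [extDerivOneForm_eq_curlWithin]
  refine (curlWithin_congr (oneFormInChart_pullback hf α hy₀) (mem_range_self _) v w).trans ?_
  refine (curlWithin_pullback (T := range I') (by rwa [hx])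
    (contDiffWithinAt_extChartAt_comp hf hy₀)
    I.uniqueDiffOn (I'.uniqueDiffOn _ (mem_range_self _))
    (I.range_subset_closure_interior (mem_range_self _)) (mem_range_self _)
    (fun y _ => mem_range_self _) v w).trans ?_
  have h1 : ∀ u : TangentSpace I x,
      fderivWithin ℝ (extChartAt I' y₀ ∘ f ∘ (extChartAt I x).symm) (range I) (extChartAt I x x) u =
        mfderiv I' 𝓘(ℝ, E') (extChartAt I' y₀) (f x) (mfderiv I I' f x u) := fun u => by
    have h2 := mfderiv_comp x (mdifferentiableAt_extChartAt (I := I') hy₀)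
      ((hf.mdifferentiable (by simp)) x)
    rw [mfderiv_extChartAt_comp hf hy₀] at h2
    exact congrArg (fun L => L u) h2
  rw [hx]
  exact congrArg₂ _ (h1 v) (h1 w)

lemma extDerivOneForm_pullback {f : X → Y} (hf : ContMDiff I I' ∞ f)
    {α : (y : Y) → TangentSpace I' y →L[ℝ] ℝ} (hα : IsSmoothOneForm I' α) (x : X)
    (v w : TangentSpace I x) : extDerivOneForm I (pullbackOneForm I f α) x v w =
      extDerivOneForm I' α (f x) (mfderiv I I' f x v) (mfderiv I I' f x w) := by
  have : IsManifold I' 1 Y := .of_le (n := ∞) (by exact_mod_cast le_top)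
  rw [extDerivOneForm_pullback_chart hf (mem_chart_source H' (f x))
    (((isSmoothOneForm_iff α).mp hα (f x)).differentiableWithinAt (by simp)),
    extDerivOneForm_eq_curlWithin, mfderiv_extChartAt_self]
  rfl

/-- Needed for continuity in the point: `extDerivOneForm` uses a different chart at each point,
whereas here one chart serves a whole neighbourhood. -/
lemma extDerivOneForm_eq_curlWithin_chart {α : (x : X) → TangentSpace I x →L[ℝ] ℝ} {x x₀ : X}
    (hx : x ∈ (chartAt H x₀).source)
    (hα : DifferentiableWithinAt ℝ (oneFormInChart I α x₀) (range I) (extChartAt I x₀ x))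
    (v w : TangentSpace I x) : extDerivOneForm I α x v w =
      curlWithin (oneFormInChart I α x₀) (range I) (extChartAt I x₀ x)
        (mfderiv I 𝓘(ℝ, E) (extChartAt I x₀) x v) (mfderiv I 𝓘(ℝ, E) (extChartAt I x₀) x w) := by
  have h := extDerivOneForm_pullback_chart (f := id) contMDiff_id (x := x) hx hα v w
  have hid : pullbackOneForm I id α = α := by
    ext1 z
    simp only [pullbackOneForm, mfderiv_id]
    rfl
  rw [hid, mfderiv_id] at h
  exact h

end OneFormCharts

/-! ### The forms `d^J h` and `dd^J h` in charts. -/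

section ComplexDifferential

open Filter Topology Set

variable {E : Type*} [NormedAddCommGroup E] [NormedSpace ℝ E]

/-- The `1`-form `-dg ∘ j` on a subset of a vector space. -/
def negFDerivComp (j : E → E →L[ℝ] E) (S : Set E) (g : E → ℝ) (y : E) : E →L[ℝ] ℝ :=
  -(fderivWithin ℝ g S y).comp (j y)

lemma contDiffWithinAt_negFDerivComp {j : E → E →L[ℝ] E} {S : Set E} {g : E → ℝ} {y₀ : E}
    (hS : UniqueDiffOn ℝ S) (hy₀ : y₀ ∈ S) (hj : ContDiffWithinAt ℝ ∞ j S y₀)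
    (hg : ContDiffWithinAt ℝ ∞ g S y₀) : ContDiffWithinAt ℝ ∞ (negFDerivComp j S g) S y₀ :=
  ((hg.fderivWithin_right (m := ∞) hS (by simp) hy₀).clm_comp hj).neg

/-- Let `u` be the exponential factor, `A = -dg ∘ j` and `B = -du ∘ j`, so that `-d(gu) ∘ j = u A +
g B`. Where `g = 0` one has `u = 1`, `du = (c/2) dg` and `B = (c/2) A`; the terms `du ∧ A` and `dg ∧
B` are then equal and add up to `c dg ∧ A`. Derivatives of `c` appear only multiplied by `g`. -/
lemma curlWithin_negFDerivComp_mul_exp {j : E → E →L[ℝ] E} {S : Set E} {g c : E → ℝ} {y₀ : E}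
    (hS : UniqueDiffOn ℝ S) (hy₀ : y₀ ∈ S) (hj : ContDiffWithinAt ℝ ∞ j S y₀)
    (hg : ContDiffWithinAt ℝ ∞ g S y₀) (hc : ContDiffWithinAt ℝ ∞ c S y₀) (h0 : g y₀ = 0)
    (v w : E) :
    curlWithin (negFDerivComp j S fun y => g y * Real.exp (c y * g y / 2)) S y₀ v w =
      curlWithin (negFDerivComp j S g) S y₀ v w +
        c y₀ * (fderivWithin ℝ g S y₀ v * negFDerivComp j S g y₀ w -
          fderivWithin ℝ g S y₀ w * negFDerivComp j S g y₀ v) := by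
  set k : E → ℝ := fun y => c y * g y / 2 with hk_def
  have hk : ContDiffWithinAt ℝ ∞ k S y₀ := (hc.mul hg).div_const 2
  set u : E → ℝ := fun y => Real.exp (k y) with hu_def
  have hu : ContDiffWithinAt ℝ ∞ u S y₀ := hk.exp
  have hUD := hS y₀ hy₀
  have hu0 : u y₀ = 1 := by simp [hu_def, hk_def, h0]
  have hdu : ∀ z, fderivWithin ℝ u S y₀ z = c y₀ / 2 * fderivWithin ℝ g S y₀ z := by
    have h1 : HasFDerivWithinAt k ((2 : ℝ)⁻¹ • (c y₀ • fderivWithin ℝ g S y₀ +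
        g y₀ • fderivWithin ℝ c S y₀)) S y₀ := by
      have : HasFDerivWithinAt _ _ S y₀ := ((hc.differentiableWithinAt (by simp)).hasFDerivWithinAt.mul
        (hg.differentiableWithinAt (by simp)).hasFDerivWithinAt).const_mul ((2 : ℝ)⁻¹)
      have hke : ∀ y, k y = (2 : ℝ)⁻¹ * (c * g) y := fun y => by
        simp only [hk_def, Pi.mul_apply]
        ring
      exact this.congr (fun y _ => hke y) (hke y₀)
    have h2 : HasFDerivWithinAt u _ S y₀ := h1.exp
    intro z
    rw [h2.fderivWithin hUD]
    have : Real.exp (k y₀) = 1 := hu0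
    simp [this, h0]
    ring
  have heq : (negFDerivComp j S fun y => g y * u y) =ᶠ[𝓝[S] y₀] fun y =>
      u y • negFDerivComp j S g y + g y • negFDerivComp j S u y := by
    have hge := hg.of_le (m := 1) (by exact_mod_cast le_top)
    have hue := hu.of_le (m := 1) (by exact_mod_cast le_top)
    have h1 := hge.eventually (by simp)
    have h2 := hue.eventually (by simp)
    rw [insert_eq_of_mem hy₀] at h1 h2
    filter_upwards [h1, h2, self_mem_nhdsWithin] with y hy1 hy2 hyS
    ext z
    simp only [negFDerivComp, fderivWithin_fun_mul (hS y hyS) (hy1.differentiableWithinAt (by simp))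
      (hy2.differentiableWithinAt (by simp))]
    simp
  have hA := (contDiffWithinAt_negFDerivComp hS hy₀ hj hg).differentiableWithinAt (by simp)
  have hB := (contDiffWithinAt_negFDerivComp hS hy₀ hj hu).differentiableWithinAt (by simp)
  have hg' := hg.differentiableWithinAt (by simp)
  have hu' := hu.differentiableWithinAt (by simp)
  have hB0 : ∀ z, negFDerivComp j S u y₀ z = c y₀ / 2 * negFDerivComp j S g y₀ z := fun z => by
    simp [negFDerivComp, hdu]
  have h1 : DifferentiableWithinAt ℝ (fun y => u y • negFDerivComp j S g y) S y₀ := hu'.smul hA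
  have h2 : DifferentiableWithinAt ℝ (fun y => g y • negFDerivComp j S u y) S y₀ := hg'.smul hB
  rw [curlWithin_congr heq hy₀, curlWithin_add hUD h1 h2,
    curlWithin_smul hUD hu' hA, curlWithin_smul hUD hg' hB, hu0, h0, hdu, hdu, hB0, hB0]
  ring

variable {H : Type*} [TopologicalSpace H]
  {I : ModelWithCorners ℝ E H} {W : Type*} [TopologicalSpace W] [ChartedSpace H W]
  [IsManifold I ∞ W]

/-- The coordinate expression of an almost complex structure in the preferred chart at `x`. -/
def AlmostComplexStructure.inChart (J : AlmostComplexStructure I W) (x : W) (y : E) : E →L[ℝ] E :=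
  (mfderiv I 𝓘(ℝ, E) (extChartAt I x) ((extChartAt I x).symm y)).comp
    ((J.toFun ((extChartAt I x).symm y)).comp
      (mfderivWithin 𝓘(ℝ, E) I (extChartAt I x).symm (range I) y))

lemma AlmostComplexStructure.contDiffWithinAt_inChart (J : AlmostComplexStructure I W) (x : W) :
    ContDiffWithinAt ℝ ∞ (J.inChart x) (range I) (extChartAt I x x) := by
  have : IsManifold I 1 W := .of_le (n := ∞) (by exact_mod_cast le_top)
  have h := ((contMDiffAt_hom_bundle _).mp (J.smooth x)).2
  have h' := (contMDiffAt_iff.mp h).2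
  refine h'.congr_of_eventuallyEq_of_mem ?_ (mem_range_self _)
  filter_upwards [extChartAt_target_mem_nhdsWithin x] with y hy
  have hz : (extChartAt I x).symm y ∈ (chartAt H x).source := by
    rw [← extChartAt_source I]
    exact (extChartAt I x).map_target hy
  have hr : extChartAt I x ((extChartAt I x).symm y) = y := (extChartAt I x).right_inv hy
  refine ContinuousLinearMap.ext fun v => ?_
  have h1 := TangentBundle.symmL_trivializationAt (𝕜 := ℝ) (I := I) hz
  have h2 := TangentBundle.continuousLinearMapAt_trivializationAt (𝕜 := ℝ) (I := I) hz
  rw [hr] at h1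
  change _ = (trivializationAt E (TangentSpace I) x).continuousLinearMapAt ℝ _
    (J.toFun _ ((trivializationAt E (TangentSpace I) x).symmL ℝ _ v))
  rw [h1, h2]
  rfl

lemma fderivWithin_comp_extChartAt_symm {h : W → ℝ} (hh : ContMDiff I 𝓘(ℝ, ℝ) ∞ h) {x : W} {y : E}
    (hy : y ∈ (extChartAt I x).target) (v : E) :
    fderivWithin ℝ (h ∘ (extChartAt I x).symm) (range I) y v =
      mfderiv I 𝓘(ℝ, ℝ) h ((extChartAt I x).symm y)
        (mfderivWithin 𝓘(ℝ, E) I (extChartAt I x).symm (range I) y v) := by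
  have : IsManifold I 1 W := .of_le (n := ∞) (by exact_mod_cast le_top)
  have hF := HasMFDerivAt.comp_hasMFDerivWithinAt y
      ((hh.mdifferentiable (by simp)) ((extChartAt I x).symm y)).hasMFDerivAt
      (mdifferentiableWithinAt_extChartAt_symm hy).hasMFDerivWithinAt
  let L : E →L[ℝ] ℝ := (mfderiv I 𝓘(ℝ, ℝ) h ((extChartAt I x).symm y)).comp
    (mfderivWithin 𝓘(ℝ, E) I (extChartAt I x).symm (range I) y)
  have hL : HasFDerivWithinAt (h ∘ (extChartAt I x).symm) L (range I) y :=
    hasMFDerivWithinAt_iff_hasFDerivWithinAt.mp hF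
  rw [hL.fderivWithin (I.uniqueDiffOn y (extChartAt_target_subset_range x hy))]
  rfl

lemma oneFormInChart_dJ (J : AlmostComplexStructure I W) {h : W → ℝ}
    (hh : ContMDiff I 𝓘(ℝ, ℝ) ∞ h) {x : W} {y : E} (hy : y ∈ (extChartAt I x).target) :
    oneFormInChart I (dJ J h) x y =
      negFDerivComp (J.inChart x) (range I) (h ∘ (extChartAt I x).symm) y := by
  have : IsManifold I 1 W := .of_le (n := ∞) (by exact_mod_cast le_top)
  refine ContinuousLinearMap.ext fun v => ?_
  have h1 := mfderivWithin_extChartAt_symm_comp_mfderiv_extChartAt (I := I) hy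
  have h2 : ∀ u : TangentSpace I ((extChartAt I x).symm y),
      mfderivWithin 𝓘(ℝ, E) I (extChartAt I x).symm (range I) y
        (mfderiv I 𝓘(ℝ, E) (extChartAt I x) ((extChartAt I x).symm y) u) = u :=
    fun u => DFunLike.congr_fun h1 u
  change -(mfderiv I 𝓘(ℝ, ℝ) h ((extChartAt I x).symm y) _) =
    -(fderivWithin ℝ (h ∘ (extChartAt I x).symm) (range I) y (J.inChart x y v))
  rw [fderivWithin_comp_extChartAt_symm hh hy]
  exact congrArg (fun u => -(mfderiv I 𝓘(ℝ, ℝ) h ((extChartAt I x).symm y) u)) (h2 _).symm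

lemma oneFormInChart_dJ_eventuallyEq (J : AlmostComplexStructure I W) {h : W → ℝ}
    (hh : ContMDiff I 𝓘(ℝ, ℝ) ∞ h) (x : W) : oneFormInChart I (dJ J h) x
      =ᶠ[𝓝[range I] (extChartAt I x x)]
        negFDerivComp (J.inChart x) (range I) (h ∘ (extChartAt I x).symm) := by
  filter_upwards [extChartAt_target_mem_nhdsWithin x] with y hy
  exact oneFormInChart_dJ J hh hy

omit [IsManifold I ∞ W] in
lemma contDiffWithinAt_comp_extChartAt_symm {h : W → ℝ} (hh : ContMDiff I 𝓘(ℝ, ℝ) ∞ h) (x : W) :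
    ContDiffWithinAt ℝ ∞ (h ∘ (extChartAt I x).symm) (range I) (extChartAt I x x) :=
  (contMDiffAt_iff.mp (hh x)).2

lemma isSmoothOneForm_dJ (J : AlmostComplexStructure I W) {h : W → ℝ}
    (hh : ContMDiff I 𝓘(ℝ, ℝ) ∞ h) : IsSmoothOneForm I (dJ J h) := by
  rw [isSmoothOneForm_iff]
  intro x
  exact (contDiffWithinAt_negFDerivComp I.uniqueDiffOn (mem_range_self _)
    (J.contDiffWithinAt_inChart x) (contDiffWithinAt_comp_extChartAt_symm hh x)
    ).congr_of_eventuallyEq_of_mem (oneFormInChart_dJ_eventuallyEq J hh x) (mem_range_self _)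

/-- The differential of a function, as a `1`-form. -/
def differential (I : ModelWithCorners ℝ E H) {W : Type*} [TopologicalSpace W] [ChartedSpace H W]
    (h : W → ℝ) (p : W) : TangentSpace I p →L[ℝ] ℝ :=
  mfderiv I 𝓘(ℝ, ℝ) h p

omit [IsManifold I ∞ W] in
lemma differential_eq_fderivWithin {h : W → ℝ} {p : W} (hh : MDifferentiableAt I 𝓘(ℝ, ℝ) h p)
    (v : TangentSpace I p) : differential I h p v =
      fderivWithin ℝ (h ∘ (extChartAt I p).symm) (range I) (extChartAt I p p) v := by
  rw [differential, hh.mfderiv]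
  rfl

lemma oneFormInChart_self (α : (x : W) → TangentSpace I x →L[ℝ] ℝ) (p : W) (v : TangentSpace I p) :
    oneFormInChart I α p (extChartAt I p p) v = α p v := by
  have : IsManifold I 1 W := .of_le (n := ∞) (by exact_mod_cast le_top)
  have h := oneFormInChart_extChartAt α (mem_chart_source H p)
  rw [mfderivWithin_range_extChartAt_symm] at h
  exact DFunLike.congr_fun h v

/-- The correction is `c · dh ∧ d^J h`, with no derivative of `c`; this is what later allows `c` to
vary from point to point. -/
lemma extDerivOneForm_dJ_mul_exp (J : AlmostComplexStructure I W) {h c : W → ℝ}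
    (hh : ContMDiff I 𝓘(ℝ, ℝ) ∞ h) (hc : ContMDiff I 𝓘(ℝ, ℝ) ∞ c) {p : W} (hp : h p = 0)
    (hhc : ContMDiff I 𝓘(ℝ, ℝ) ∞ fun q => h q * Real.exp (c q * h q / 2))
    (v w : TangentSpace I p) :
    extDerivOneForm I (dJ J fun q => h q * Real.exp (c q * h q / 2)) p v w =
      extDerivOneForm I (dJ J h) p v w + c p * (differential I h p v * dJ J h p w -
        differential I h p w * dJ J h p v) := by
  have hmem : extChartAt I p p ∈ range I := mem_range_self _
  have hself : ∀ u : TangentSpace I p, dJ J h p u = negFDerivComp (J.inChart p) (range I)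
      (h ∘ (extChartAt I p).symm) (extChartAt I p p) u := fun u => by
    rw [← oneFormInChart_dJ J hh (mem_extChartAt_target p)]
    exact (oneFormInChart_self _ _ _).symm
  rw [extDerivOneForm_eq_curlWithin, extDerivOneForm_eq_curlWithin]
  have h1 := curlWithin_negFDerivComp_mul_exp I.uniqueDiffOn hmem (J.contDiffWithinAt_inChart p)
    (contDiffWithinAt_comp_extChartAt_symm hh p) (contDiffWithinAt_comp_extChartAt_symm hc p)
    (by simpa using hp) v w
  have h2 := curlWithin_congr (oneFormInChart_dJ_eventuallyEq J hhc p) hmem v w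
  have h3 := curlWithin_congr (oneFormInChart_dJ_eventuallyEq J hh p) hmem v w
  refine h2.trans (h1.trans ?_)
  have hd := (hh p).mdifferentiableAt (by simp)
  rw [hself, hself, differential_eq_fderivWithin hd, differential_eq_fderivWithin hd]
  refine congrArg₂ _ h3.symm ?_
  simp

/-- Plurisubharmonicity at a point is an open condition. -/
lemma eventually_plurisubharmonic [FiniteDimensional ℝ E] (J : AlmostComplexStructure I W)
    {h : W → ℝ} (hh : ContMDiff I 𝓘(ℝ, ℝ) ∞ h) {p : W}
    (hp : ∀ v : TangentSpace I p, v ≠ 0 → 0 < extDerivOneForm I (dJ J h) p v (J.toFun p v)) :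
    ∀ᶠ q in 𝓝 p, ∀ v : TangentSpace I q, v ≠ 0 →
      0 < extDerivOneForm I (dJ J h) q v (J.toFun q v) := by
  have : IsManifold I 1 W := .of_le (n := ∞) (by exact_mod_cast le_top)
  set φ := extChartAt I p with hφ
  set a := oneFormInChart I (dJ J h) p with ha_def
  have hmem : φ p ∈ range I := mem_range_self _
  have ha : ContDiffWithinAt ℝ ∞ a (range I) (φ p) :=
    (isSmoothOneForm_iff _).mp (isSmoothOneForm_dJ J hh) p
  have hD : ContinuousWithinAt (fderivWithin ℝ a (range I)) (range I) (φ p) :=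
    (ha.fderivWithin_right (m := ∞) I.uniqueDiffOn (by simp) hmem).continuousWithinAt
  have hJ : ContinuousWithinAt (J.inChart p) (range I) (φ p) :=
    (J.contDiffWithinAt_inChart p).continuousWithinAt
  have hφt : Tendsto φ (𝓝 p) (𝓝[range I] (φ p)) :=
    tendsto_nhdsWithin_iff.mpr ⟨continuousAt_extChartAt p, Eventually.of_forall fun q =>
      mem_range_self _⟩
  -- The Levi form read in the fixed chart at `p`. It is homogeneous of degree two in `u`, so
  -- positivity need only be checked on the compact unit sphere.
  let G : W → E → ℝ := fun q u => curlWithin a (range I) (φ q) u (J.inChart p (φ q) u)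
  have hGsmul : ∀ q (r : ℝ) u, G q (r • u) = r ^ 2 * G q u := fun q r u => by
    simp only [G, curlWithin, map_smul, smul_apply, smul_eq_mul]
    ring
  have hdiff : ∀ᶠ q in 𝓝 p, DifferentiableWithinAt ℝ a (range I) (φ q) := by
    have h1 := (ha.of_le (m := 1) (by exact_mod_cast le_top)).eventually (by simp)
    rw [insert_eq_of_mem hmem] at h1
    exact (hφt.eventually h1).mono fun q hq => hq.differentiableWithinAt (by simp)
  have hkey : ∀ᶠ q in 𝓝 p, ∀ v : TangentSpace I q,
      extDerivOneForm I (dJ J h) q v (J.toFun q v) = G q (mfderiv I 𝓘(ℝ, E) φ q v) := by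
    filter_upwards [hdiff, chart_source_mem_nhds H p] with q hq hqs v
    rw [extDerivOneForm_eq_curlWithin_chart hqs hq]
    refine congrArg (curlWithin a (range I) (φ q) _) ?_
    have hinv : φ.symm (φ q) = q := φ.left_inv (by rwa [hφ, extChartAt_source])
    have h1 := mfderivWithin_extChartAt_symm_comp_mfderiv_extChartAt' (I := I) (x := p)
      (y := q) (by rwa [extChartAt_source])
    have hT : ∀ q', q' = q → ∀ u : E,
        (mfderiv I 𝓘(ℝ, E) φ q' : E →L[ℝ] E) ((J.toFun q' : E →L[ℝ] E) u) =
        (mfderiv I 𝓘(ℝ, E) φ q : E →L[ℝ] E) ((J.toFun q : E →L[ℝ] E) u) := by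
      rintro q' rfl u
      rfl
    refine Eq.trans ?_ (hT _ hinv _).symm
    exact congrArg (fun u => mfderiv I 𝓘(ℝ, E) φ q (J.toFun q u)) (DFunLike.congr_fun h1 v).symm
  have hbij : ∀ᶠ q in 𝓝 p, Function.Bijective (mfderiv I 𝓘(ℝ, E) φ q) := by
    filter_upwards [chart_source_mem_nhds H p] with q hq
    exact (isInvertible_mfderiv_extChartAt (I := I) (by rwa [extChartAt_source])).bijective
  have hsphere : ∀ᶠ q in 𝓝 p, ∀ u ∈ Metric.sphere (0 : E) 1, 0 < G q u := by
    refine (isCompact_sphere (0 : E) 1).eventually_forall_of_forall_eventually fun u hu => ?_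
    have hc : ContinuousAt (fun z : W × E => G z.1 z.2) (p, u) := by
      have hD' : ContinuousAt (fun z : W × E => fderivWithin ℝ a (range I) (φ z.1)) (p, u) :=
        (hD.tendsto.comp hφt).comp continuousAt_fst
      have hJ' : ContinuousAt (fun z : W × E => J.inChart p (φ z.1)) (p, u) :=
        (hJ.tendsto.comp hφt).comp continuousAt_fst
      have hJu := hJ'.clm_apply continuousAt_snd
      exact ((hD'.clm_apply continuousAt_snd).clm_apply hJu).sub
        ((hD'.clm_apply hJu).clm_apply continuousAt_snd)
    refine hc.eventually (lt_mem_nhds ?_)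
    have hu0 : u ≠ 0 := by
      rintro rfl
      simp at hu
    obtain ⟨v, rfl⟩ := hbij.self_of_nhds.2 u
    change 0 < G p _
    rw [← hkey.self_of_nhds]
    refine hp v ?_
    rintro rfl
    exact hu0 (map_zero _)
  filter_upwards [hkey, hbij, hsphere] with q hq hb hs v hv
  rw [hq]
  set u : E := mfderiv I 𝓘(ℝ, E) φ q v with hu_def
  have hu : u ≠ 0 := fun h0 => hv (hb.1 (h0.trans (map_zero _).symm))
  have hn : 0 < ‖u‖ := norm_pos_iff.mpr hu
  have h1 := hs (‖u‖⁻¹ • u) (by simp [norm_smul, hn.ne'])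
  rw [hGsmul] at h1
  exact pos_of_mul_pos_right h1 (by positivity)

end ComplexDifferential

/-! ### Boundary defining functions. -/

section HalfSpace

open Filter Topology Set

variable {m : ℕ} [NeZero m] {W : Type*} [TopologicalSpace W] [ChartedSpace (EuclideanHalfSpace m) W]

/-- The differential of a function at a local maximum is nonpositive on inward vectors. -/
lemma differential_nonpos_of_isLocalMax {h : W → ℝ} {p : W}
    (hh : MDifferentiableAt (𝓡∂ m) 𝓘(ℝ, ℝ) h p) (hmax : IsLocalMax h p)
    (v : EuclideanSpace ℝ (Fin m)) (hv : 0 ≤ v 0) : differential (𝓡∂ m) h p v ≤ 0 := by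
  have h1 := differential_eq_fderivWithin hh v
  refine h1.trans_le (IsLocalMaxOn.fderivWithin_nonpos ?_ ?_)
  · have h2 : Tendsto (extChartAt (𝓡∂ m) p).symm
        (𝓝[range (𝓡∂ m)] (extChartAt (𝓡∂ m) p p)) (𝓝 p) := by
      have := (continuousAt_extChartAt_symm (I := 𝓡∂ m) p).tendsto
      rw [extChartAt_to_inv] at this
      exact this.mono_left nhdsWithin_le_nhds
    have h3 := h2.eventually hmax
    change ∀ᶠ y in _, (h ∘ (extChartAt (𝓡∂ m) p).symm) y ≤
      (h ∘ (extChartAt (𝓡∂ m) p).symm) (extChartAt (𝓡∂ m) p p)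
    simpa only [Function.comp_apply, extChartAt_to_inv] using h3
  · refine mem_posTangentConeAt_of_frequently_mem (Eventually.frequently ?_)
    filter_upwards [self_mem_nhdsWithin] with t ht
    have hp : extChartAt (𝓡∂ m) p p ∈ range (𝓡∂ m) := mem_range_self _
    rw [range_modelWithCornersEuclideanHalfSpace] at hp ⊢
    have ht' : (0 : ℝ) < t := ht
    have hp' : 0 ≤ (extChartAt (𝓡∂ m) p p) 0 := hp
    change 0 ≤ (extChartAt (𝓡∂ m) p p + t • v) 0
    simp only [PiLp.add_apply, PiLp.smul_apply, smul_eq_mul]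
    positivity

lemma extChartAt_zero_nonneg (x q : W) : 0 ≤ (extChartAt (𝓡∂ m) x q) 0 := by
  have : extChartAt (𝓡∂ m) x q ∈ range (𝓡∂ m) := mem_range_self _
  rwa [range_modelWithCornersEuclideanHalfSpace] at this

variable [IsManifold (𝓡∂ m) ∞ W]

/-- On a smooth manifold interior points may be recognized in any chart of the atlas, not only in
the preferred one, and the frontier of the half-space is `{y₀ = 0}`. -/
lemma mem_boundary_iff_extChartAt_zero {x q : W} (hq : q ∈ (chartAt (EuclideanHalfSpace m) x).source) :
    q ∈ (𝓡∂ m).boundary W ↔ (extChartAt (𝓡∂ m) x q) 0 = 0 := by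
  have h1 := (𝓡∂ m).isInteriorPoint_iff_of_mem_atlas (n := ∞) (by simp)
    (chart_mem_atlas (EuclideanHalfSpace m) x) hq
  have h2 : extChartAt (𝓡∂ m) x q ∈ interior (extChartAt (𝓡∂ m) x).target ↔
      extChartAt (𝓡∂ m) x q ∈ interior (range (𝓡∂ m)) :=
    ⟨fun h => OpenPartialHomeomorph.interior_extend_target_subset_interior_range _ h,
      fun h => (chartAt (EuclideanHalfSpace m) x).mem_interior_extend_target
        ((chartAt (EuclideanHalfSpace m) x).map_source hq) h⟩
  have h3 : extChartAt (𝓡∂ m) x q ∈ frontier (range (𝓡∂ m)) ↔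
      ¬ extChartAt (𝓡∂ m) x q ∈ interior (range (𝓡∂ m)) := by
    rw [(𝓡∂ m).isClosed_range.frontier_eq]
    exact ⟨fun h => h.2, fun h => ⟨mem_range_self _, h⟩⟩
  change (𝓡∂ m).IsBoundaryPoint q ↔ _
  rw [(𝓡∂ m).isBoundaryPoint_iff_not_isInteriorPoint, h1]
  refine (not_congr h2).trans (h3.symm.trans ?_)
  rw [frontier_range_modelWithCornersEuclideanHalfSpace]
  exact eq_comm

lemma contMDiffAt_extChartAt_zero {x q : W} (hq : q ∈ (chartAt (EuclideanHalfSpace m) x).source) :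
    ContMDiffAt (𝓡∂ m) 𝓘(ℝ, ℝ) ∞ (fun z => (extChartAt (𝓡∂ m) x z) 0) q := by
  have h1 : ContMDiff 𝓘(ℝ, EuclideanSpace ℝ (Fin m)) 𝓘(ℝ, ℝ) ∞
      (EuclideanSpace.proj 0 : EuclideanSpace ℝ (Fin m) →L[ℝ] ℝ) :=
    ContinuousLinearMap.contMDiff _
  exact h1.contMDiffAt.comp q (contMDiffAt_extChartAt' hq)

lemma differential_extChartAt_zero {x q : W}
    (hq : q ∈ (chartAt (EuclideanHalfSpace m) x).source) (v : EuclideanSpace ℝ (Fin m)) :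
    differential (𝓡∂ m) (fun z => (extChartAt (𝓡∂ m) x z) 0) q v =
      (show EuclideanSpace ℝ (Fin m) from
        mfderiv (𝓡∂ m) 𝓘(ℝ, EuclideanSpace ℝ (Fin m)) (extChartAt (𝓡∂ m) x) q v) 0 := by
  have : IsManifold (𝓡∂ m) 1 W := .of_le (n := ∞) (by exact_mod_cast le_top)
  let L : EuclideanSpace ℝ (Fin m) →L[ℝ] ℝ := EuclideanSpace.proj 0
  have h := mfderiv_comp q (g := L) (L.mdifferentiableAt)
    (mdifferentiableAt_extChartAt (I := 𝓡∂ m) hq)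
  have hL : mfderiv 𝓘(ℝ, EuclideanSpace ℝ (Fin m)) 𝓘(ℝ, ℝ) L (extChartAt (𝓡∂ m) x q) = L :=
    L.mfderiv_eq
  rw [hL] at h
  exact DFunLike.congr_fun h v

/-- A manifold with boundary has a boundary defining function. -/
lemma exists_boundary_defining_function [T2Space W] [SigmaCompactSpace W] :
    ∃ h : W → ℝ, ContMDiff (𝓡∂ m) 𝓘(ℝ, ℝ) ∞ h ∧ (∀ p, h p ≤ 0) ∧
      (∀ p, h p = 0 ↔ p ∈ (𝓡∂ m).boundary W) ∧
      ∀ p, h p = 0 → differential (𝓡∂ m) h p ≠ 0 := by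
  have : IsManifold (𝓡∂ m) 1 W := .of_le (n := ∞) (by exact_mod_cast le_top)
  obtain ⟨ρ, hρ⟩ := SmoothPartitionOfUnity.exists_isSubordinate (𝓡∂ m) (s := (univ : Set W))
    isClosed_univ (fun x : W => (chartAt (EuclideanHalfSpace m) x).source)
    (fun x => (chartAt (EuclideanHalfSpace m) x).open_source)
    (fun x _ => mem_iUnion.mpr ⟨x, mem_chart_source _ x⟩)
  let g : W → W → ℝ := fun x q => (extChartAt (𝓡∂ m) x q) 0
  -- The `0`-th chart coordinates, nonnegative and zero exactly on the boundary, averaged by a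
  -- partition of unity.
  let k : W → ℝ := fun q => ∑ᶠ x, ρ x q • g x q
  have hk : ContMDiff (𝓡∂ m) 𝓘(ℝ, ℝ) ∞ k :=
    hρ.contMDiff_finsum_smul (fun x => (chartAt (EuclideanHalfSpace m) x).open_source)
      (fun x q hq => (contMDiffAt_extChartAt_zero hq).contMDiffWithinAt)
  have hterm : ∀ q x, 0 ≤ ρ x q • g x q := fun q x =>
    mul_nonneg (ρ.nonneg x q) (extChartAt_zero_nonneg x q)
  have hfin : ∀ q, (Function.support fun x => ρ x q • g x q).Finite := fun q => by
    refine (ρ.locallyFinite.point_finite q).subset fun x hx => ?_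
    rw [Function.mem_support] at hx
    exact fun h0 => hx (by rw [h0, zero_smul])
  have hle : ∀ q x, ρ x q * g x q ≤ k q := fun q x => single_le_finsum x (hfin q) (hterm q)
  have hsrc : ∀ q x, ρ x q ≠ 0 → q ∈ (chartAt (EuclideanHalfSpace m) x).source := fun q x h =>
    hρ x (subset_tsupport _ h)
  have hzero : ∀ q, k q = 0 ↔ q ∈ (𝓡∂ m).boundary W := by
    intro q
    constructor
    · intro h0
      obtain ⟨x, hx⟩ := ρ.exists_pos_of_mem (mem_univ q)
      have hq := hsrc q x hx.ne'
      rw [mem_boundary_iff_extChartAt_zero hq]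
      refine le_antisymm ?_ (extChartAt_zero_nonneg x q)
      have := hle q x
      rw [h0] at this
      exact nonpos_of_mul_nonpos_right this hx
    · intro hq
      refine (finsum_congr fun x => ?_).trans finsum_zero
      by_cases hx : ρ x q = 0
      · rw [hx, zero_smul]
      · have : g x q = 0 := (mem_boundary_iff_extChartAt_zero (hsrc q x hx)).mp hq
        rw [this, smul_zero]
  refine ⟨fun q => -k q, hk.neg, fun q => neg_nonpos.mpr (finsum_nonneg (hterm q)),
    fun q => by rw [neg_eq_zero, hzero], fun p hp hd => ?_⟩
  rw [neg_eq_zero] at hp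
  obtain ⟨x, hx⟩ := ρ.exists_pos_of_mem (mem_univ p)
  have hps := hsrc p x hx.ne'
  have hgp : g x p = 0 := (mem_boundary_iff_extChartAt_zero hps).mp ((hzero p).mp hp)
  have hg : MDifferentiableAt (𝓡∂ m) 𝓘(ℝ, ℝ) (g x) p :=
    (contMDiffAt_extChartAt_zero hps).mdifferentiableAt (by simp)
  have hk' : MDifferentiableAt (𝓡∂ m) 𝓘(ℝ, ℝ) (fun q => -k q) p :=
    (hk.neg p).mdifferentiableAt (by simp)
  -- Suppose `dk = 0` at `p`. Near `p` one has `k ≥ ρ x · g x ≥ ε g x`, so `ε g x - k` has a local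
  -- maximum at `p`, and so does `-g x`. On inward vectors this forces both `d(g x) ≤ 0` and `d(g x)
  -- ≥ 0`. Hence `d(g x) = 0`, which is impossible for a coordinate of a chart.
  set ε := ρ x p / 2 with hε
  have hε0 : 0 < ε := by positivity
  have hεg : MDifferentiableAt (𝓡∂ m) 𝓘(ℝ, ℝ) (ε • g x) p := hg.const_smul ε
  have hmax1 : IsLocalMax (ε • g x + fun q => -k q) p := by
    have h1 : ∀ᶠ q in 𝓝 p, ε < ρ x q :=
      (ρ x).contMDiff.continuous.continuousAt.eventually (lt_mem_nhds (by rw [hε]; linarith))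
    filter_upwards [h1] with q hq
    simp only [Pi.add_apply, Pi.smul_apply, smul_eq_mul, hgp, hp]
    have h2 := hle q x
    have h3 : 0 ≤ g x q := extChartAt_zero_nonneg x q
    nlinarith
  have hmax2 : IsLocalMax (-g x) p := by
    refine Eventually.of_forall fun q => ?_
    simp only [Pi.neg_apply, hgp, neg_zero, neg_nonpos]
    exact extChartAt_zero_nonneg x q
  have hl : ∀ v : EuclideanSpace ℝ (Fin m), 0 ≤ v 0 → differential (𝓡∂ m) (g x) p v = 0 := by
    intro v hv
    have h1 := differential_nonpos_of_isLocalMax (hεg.add hk') hmax1 v hv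
    have h2 := differential_nonpos_of_isLocalMax hg.neg hmax2 v hv
    have e1 : differential (𝓡∂ m) (ε • g x + fun q => -k q) p v =
        ε * differential (𝓡∂ m) (g x) p v + differential (𝓡∂ m) (fun q => -k q) p v := by
      have h3 : differential (𝓡∂ m) (ε • g x + fun q => -k q) p v =
        differential (𝓡∂ m) (ε • g x) p v + differential (𝓡∂ m) (fun q => -k q) p v :=
        DFunLike.congr_fun (mfderiv_add hεg hk') v
      have h4 : differential (𝓡∂ m) (ε • g x) p v = ε * differential (𝓡∂ m) (g x) p v :=
        DFunLike.congr_fun (const_smul_mfderiv hg ε) v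
      rw [h3, h4]
    have e2 : differential (𝓡∂ m) (-g x) p v = -differential (𝓡∂ m) (g x) p v :=
      DFunLike.congr_fun (mfderiv_neg (f := g x) (x := p)) v
    have e3 : differential (𝓡∂ m) (fun q => -k q) p v = 0 := DFunLike.congr_fun hd v
    rw [e1, e3] at h1
    rw [e2] at h2
    nlinarith
  have hl' : ∀ v : EuclideanSpace ℝ (Fin m), differential (𝓡∂ m) (g x) p v = 0 := by
    intro v
    rcases le_total 0 (v 0) with hv | hv
    · exact hl v hv
    · have h1 := hl (-v) (by simpa using hv)
      have h2 : differential (𝓡∂ m) (g x) p (-v) = -differential (𝓡∂ m) (g x) p v := map_neg _ _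
      linarith
  obtain ⟨v, hv⟩ := (isInvertible_mfderiv_extChartAt (I := 𝓡∂ m) (x := x) (y := p)
    (by rwa [extChartAt_source])).surjective (EuclideanSpace.single 0 1 : EuclideanSpace ℝ (Fin m))
  have h1 := (differential_extChartAt_zero hps v).symm.trans (hl' v)
  rw [hv] at h1
  simp at h1

end HalfSpace

open Filter Topology Set

/-! ### Exterior derivatives of proportional one-forms. -/

section Proportional

variable {E : Type*} [NormedAddCommGroup E] [NormedSpace ℝ E] {H : Type*} [TopologicalSpace H]
  {I : ModelWithCorners ℝ E H} {X : Type*} [TopologicalSpace X] [ChartedSpace H X]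

/-- `curlWithin` as a bilinear map. -/
def curlWithinLinear (a : E → E →L[ℝ] ℝ) (S : Set E) (y : E) : E →ₗ[ℝ] E →ₗ[ℝ] ℝ :=
  LinearMap.mk₂ ℝ (curlWithin a S y)
    (fun u v w => by simp only [curlWithin, map_add, add_apply]; ring)
    (fun c v w => by simp only [curlWithin, map_smul, smul_apply, smul_eq_mul]; ring)
    (fun u v w => by simp only [curlWithin, map_add, add_apply]; ring)
    (fun c v w => by simp only [curlWithin, map_smul, smul_apply, smul_eq_mul]; ring)

/-- The exterior derivative of a `1`-form at a point, as a bilinear map. -/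
def extDerivLinear (I : ModelWithCorners ℝ E H) (α : (x : X) → TangentSpace I x →L[ℝ] ℝ) (x : X) :
    TangentSpace I x →ₗ[ℝ] TangentSpace I x →ₗ[ℝ] ℝ :=
  curlWithinLinear (E := E) (oneFormInChart I α x) (range I) (extChartAt I x x)

lemma extDerivLinear_apply (α : (x : X) → TangentSpace I x →L[ℝ] ℝ) (x : X)
    (v w : TangentSpace I x) : extDerivLinear I α x v w = extDerivOneForm I α x v w :=
  (extDerivOneForm_eq_curlWithin α x v w).symm

lemma extDerivOneForm_skew (α : (x : X) → TangentSpace I x →L[ℝ] ℝ) (x : X)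
    (v w : TangentSpace I x) : extDerivOneForm I α x v w = -extDerivOneForm I α x w v := by
  simp only [extDerivOneForm_eq_curlWithin, curlWithin]
  ring

variable [IsManifold I ∞ X]

/-- On their common kernel, the exterior derivatives of proportional `1`-forms are proportional. -/
lemma extDerivOneForm_of_proportional {α β : (x : X) → TangentSpace I x →L[ℝ] ℝ}
    (hα : IsSmoothOneForm I α) (hβ : IsSmoothOneForm I β)
    (hαβ : ∀ x, ∃ c : ℝ, ∀ v, α x v = c * β x v) (x : X) (r v w : TangentSpace I x)
    (hv : β x v = 0) (hw : β x w = 0) :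
    β x r * extDerivOneForm I α x v w = α x r * extDerivOneForm I β x v w := by
  set a : E → E →L[ℝ] ℝ := oneFormInChart I α x
  set b : E → E →L[ℝ] ℝ := oneFormInChart I β x
  set y₀ := extChartAt I x x
  have hy₀ : y₀ ∈ range I := mem_range_self _
  have ha : DifferentiableWithinAt ℝ a (range I) y₀ :=
    ((isSmoothOneForm_iff α).mp hα x).differentiableWithinAt (by simp)
  have hb : DifferentiableWithinAt ℝ b (range I) y₀ :=
    ((isSmoothOneForm_iff β).mp hβ x).differentiableWithinAt (by simp)
  let r' : E := r
  have hUD := I.uniqueDiffOn y₀ hy₀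
  have hcongr : ∀ y, b y r' • a y = a y r' • b y := by
    intro y
    obtain ⟨c, hc⟩ := hαβ ((extChartAt I x).symm y)
    have hab : ∀ u : E, a y u = c * b y u := fun u => hc _
    refine ContinuousLinearMap.ext fun u => ?_
    change b y r' * a y u = a y r' * b y u
    rw [hab, hab]
    ring
  have h1 := curlWithin_smul hUD (hb.clm_apply (differentiableWithinAt_const r')) ha v w
  have h2 := curlWithin_smul hUD (ha.clm_apply (differentiableWithinAt_const r')) hb v w
  have h3 := curlWithin_congr (S := range I) (y := y₀) (Eventually.of_forall hcongr) hy₀ v w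
  obtain ⟨c, hc⟩ := hαβ x
  have hav : ∀ u, a y₀ u = α x u := fun u => oneFormInChart_self α x u
  have hbv : ∀ u, b y₀ u = β x u := fun u => oneFormInChart_self β x u
  have e : ∀ u, β x u = 0 → α x u = 0 := fun u hu => by rw [hc, hu, mul_zero]
  have av : a y₀ v = 0 := (hav v).trans (e v hv)
  have aw : a y₀ w = 0 := (hav w).trans (e w hw)
  have bv : b y₀ v = 0 := (hbv v).trans hv
  have bw : b y₀ w = 0 := (hbv w).trans hw
  have ar : a y₀ r' = α x r := hav r
  have br : b y₀ r' = β x r := hbv r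
  rw [av, aw, br] at h1
  rw [bv, bw, ar] at h2
  rw [extDerivOneForm_eq_curlWithin, extDerivOneForm_eq_curlWithin]
  have h4 := h1.symm.trans (h3.trans h2)
  simp only [mul_zero, sub_zero, add_zero] at h4
  exact h4

end Proportional

/-! ### A positivity criterion by compactness of the sphere. -/

section Compactness

/-- A quadratic function that is positive on the zeros of a nonnegative one becomes positive
definite after adding a large multiple of the latter. -/
lemma exists_forall_add_mul_pos {E : Type*} [NormedAddCommGroup E] [NormedSpace ℝ E]
    [FiniteDimensional ℝ E] {Q N : E → ℝ} (hQ : Continuous Q) (hN : Continuous N)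
    (hQs : ∀ (r : ℝ) v, Q (r • v) = r ^ 2 * Q v) (hNs : ∀ (r : ℝ) v, N (r • v) = r ^ 2 * N v)
    (hN0 : ∀ v, 0 ≤ N v) (h : ∀ v, v ≠ 0 → N v = 0 → 0 < Q v) :
    ∃ c : ℝ, ∀ v, v ≠ 0 → 0 < Q v + c * N v := by
  have key : ∀ᶠ c : ℝ in atTop, ∀ u ∈ Metric.sphere (0 : E) 1, 0 < Q u + c * N u := by
    refine (isCompact_sphere (0 : E) 1).induction_on
      (p := fun s => ∀ᶠ c : ℝ in atTop, ∀ u ∈ s, 0 < Q u + c * N u) (by simp)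
      (fun s t hst ht => ht.mono fun c hc u hu => hc u (hst hu))
      (fun s t hs ht => (hs.and ht).mono fun c hc u hu => hu.elim (hc.1 u) (hc.2 u)) ?_
    intro u hu
    have hu0 : u ≠ 0 := by
      rintro rfl
      simp at hu
    rcases (hN0 u).eq_or_lt with h0 | h0
    · refine ⟨{z | 0 < Q z}, mem_nhdsWithin_of_mem_nhds
        (hQ.continuousAt.eventually (lt_mem_nhds (h u hu0 h0.symm))), ?_⟩
      filter_upwards [eventually_ge_atTop 0] with c hc z hz
      exact add_pos_of_pos_of_nonneg hz (mul_nonneg hc (hN0 z))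
    -- On this neighbourhood `Q + c N > Q u - 1 + c (N u / 2)`, which is nonnegative beyond the
    -- threshold imposed on `c` below.
    · refine ⟨{z | Q u - 1 < Q z ∧ N u / 2 < N z}, mem_nhdsWithin_of_mem_nhds
        ((hQ.continuousAt.eventually (lt_mem_nhds (by linarith))).and
          (hN.continuousAt.eventually (lt_mem_nhds (by linarith)))), ?_⟩
      filter_upwards [eventually_ge_atTop 0,
        eventually_ge_atTop ((1 - Q u) / (N u / 2))] with c hc hc' z hz
      rw [div_le_iff₀ (by positivity)] at hc'
      have := mul_le_mul_of_nonneg_left hz.2.le hc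
      linarith [hz.1]
  obtain ⟨c, hc⟩ := key.exists
  refine ⟨c, fun v hv => ?_⟩
  have hn : 0 < ‖v‖ := norm_pos_iff.mpr hv
  have h1 := hc (‖v‖⁻¹ • v) (by simp [norm_smul, hn.ne'])
  rw [hQs, hNs, mul_left_comm, ← mul_add] at h1
  exact pos_of_mul_pos_right h1 (by positivity)

end Compactness

/-! ### The boundary seen through a defining function. -/

section Boundary

variable {n : ℕ} {W : Type*} [TopologicalSpace W] [ChartedSpace (EuclideanHalfSpace (2 * n + 2)) W]

/-- `h` is a boundary defining function of `W`, with nonpositive values. -/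
structure IsBoundaryDefining (h : W → ℝ) : Prop where
  contMDiff : ContMDiff (𝓡∂ (2 * n + 2)) 𝓘(ℝ, ℝ) ∞ h
  nonpos : ∀ p, h p ≤ 0
  eq_zero_iff : ∀ p, h p = 0 ↔ p ∈ (𝓡∂ (2 * n + 2)).boundary W
  differential_ne_zero : ∀ p, h p = 0 → differential (𝓡∂ (2 * n + 2)) h p ≠ 0

namespace IsBoundaryDefining

variable {h : W → ℝ} (hd : IsBoundaryDefining (n := n) h)

include hd

lemma differential_nonpos {p : W} (hp : h p = 0) (v : EuclideanSpace ℝ (Fin (2 * n + 2)))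
    (hv : 0 ≤ v 0) : differential (𝓡∂ (2 * n + 2)) h p v ≤ 0 :=
  differential_nonpos_of_isLocalMax (hd.contMDiff.mdifferentiable (by simp) p)
    (Eventually.of_forall fun q => by rw [hp]; exact hd.nonpos q) v hv

/-- `dh` is nonpositive on the closed half-space of inward vectors and is not zero, so it is
strictly positive on the complementary open half-space. -/
lemma isOutward_iff {p : W} (hp : h p = 0) (Y : TangentSpace (𝓡∂ (2 * n + 2)) p) :
    IsOutward (n := n) p Y ↔ 0 < differential (𝓡∂ (2 * n + 2)) h p Y := by
  let l : EuclideanSpace ℝ (Fin (2 * n + 2)) →L[ℝ] ℝ := differential (𝓡∂ (2 * n + 2)) h p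
  let y : EuclideanSpace ℝ (Fin (2 * n + 2)) := Y
  have hl : ∀ v, 0 ≤ v 0 → l v ≤ 0 := hd.differential_nonpos hp
  change y 0 < 0 ↔ 0 < l y
  constructor
  · intro hy
    by_contra! hly
    obtain ⟨u, hu⟩ : ∃ u, l u ≠ 0 := by
      by_contra! h0
      exact hd.differential_ne_zero p hp (ContinuousLinearMap.ext h0)
    obtain ⟨u, hu⟩ : ∃ u, 0 < l u := by
      rcases hu.lt_or_gt with h1 | h1
      · exact ⟨-u, by rw [map_neg]; linarith⟩
      · exact ⟨u, h1⟩
    -- Small enough that `-y + s • u` still has nonnegative `0`-th coordinate, although `dh` would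
    -- be positive on it.
    set s := -y 0 / (|u 0| + 1) with hs
    have hs0 : 0 < s := div_pos (by linarith) (by positivity)
    have hs1 : s * (|u 0| + 1) = -y 0 := div_mul_cancel₀ _ (by positivity)
    have h1 := hl (-y + s • u) (by
      simp only [PiLp.add_apply, PiLp.neg_apply, PiLp.smul_apply, smul_eq_mul]
      nlinarith [neg_abs_le (u 0)])
    rw [map_add, map_neg, map_smul, smul_eq_mul] at h1
    nlinarith [mul_pos hs0 hu]
  · intro hly
    by_contra! h0
    exact absurd (hl y h0) (not_le.mpr hly)

variable [IsManifold (𝓡∂ (2 * n + 2)) ∞ W]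
  {M : Type*} [TopologicalSpace M] [ChartedSpace (EuclideanSpace ℝ (Fin (2 * n + 1))) M]
  [IsManifold (𝓡 (2 * n + 1)) ∞ M] {ι : M → W} (hι : IsBoundaryInclusion (n := n) ι)
  (J : AlmostComplexStructure (𝓡∂ (2 * n + 2)) W)

include hι

omit [IsManifold (𝓡∂ (2 * n + 2)) ∞ W] [IsManifold (𝓡 (2 * n + 1)) ∞ M] in
lemma apply_inclusion (x : M) : h (ι x) = 0 := by
  rw [hd.eq_zero_iff, ← hι.range_eq]
  exact mem_range_self x

omit [IsManifold (𝓡∂ (2 * n + 2)) ∞ W] [IsManifold (𝓡 (2 * n + 1)) ∞ M] in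
lemma differential_dIncl (x : M) (v : TangentSpace (𝓡 (2 * n + 1)) x) :
    differential (𝓡∂ (2 * n + 2)) h (ι x) (dIncl ι x v) = 0 := by
  have h1 := mfderiv_comp x (hd.contMDiff.mdifferentiable (by simp) (ι x))
    (hι.contMDiff.mdifferentiable (by simp) x)
  have h2 : h ∘ ι = fun _ => 0 := funext fun y => hd.apply_inclusion hι y
  rw [h2, mfderiv_const] at h1
  exact (DFunLike.congr_fun h1 v).symm

omit [IsManifold (𝓡∂ (2 * n + 2)) ∞ W] [IsManifold (𝓡 (2 * n + 1)) ∞ M] in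
lemma range_dIncl (x : M) : LinearMap.range (dIncl ι x).toLinearMap =
    LinearMap.ker (differential (𝓡∂ (2 * n + 2)) h (ι x)).toLinearMap := by
  refine range_eq_ker_of_finrank (m := 2 * n + 1) finrank_euclideanSpace_fin
    finrank_euclideanSpace_fin _ (hι.injective_dIncl x) _ (fun h0 => ?_)
    (fun v => hd.differential_dIncl hι x v)
  exact hd.differential_ne_zero _ (hd.apply_inclusion hι x)
    (ContinuousLinearMap.ext fun v => DFunLike.congr_fun h0 v)

omit [IsManifold (𝓡 (2 * n + 1)) ∞ M] in
-- Because `J² = -1`, lying in `TM ∩ J·TM` means that both `v` and `Jv` are tangent, and tangency is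
-- the vanishing of `dh`.
lemma mem_complexTangencies_iff (x : M) (v : TangentSpace (𝓡 (2 * n + 1)) x) :
    v ∈ complexTangencies J ι x ↔ pullbackOneForm (𝓡 (2 * n + 1)) ι (dJ J h) x v = 0 := by
  have hr : ∀ u, u ∈ LinearMap.range (dIncl ι x).toLinearMap ↔
      differential (𝓡∂ (2 * n + 2)) h (ι x) u = 0 := fun u => by
    rw [hd.range_dIncl hι x]
    rfl
  have ha : pullbackOneForm (𝓡 (2 * n + 1)) ι (dJ J h) x v = 0 ↔
      differential (𝓡∂ (2 * n + 2)) h (ι x) (J.toFun (ι x) (dIncl ι x v)) = 0 := neg_eq_zero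
  rw [ha, ← hr]
  change (_ ∧ ∃ u, u ∈ LinearMap.range (dIncl ι x).toLinearMap ∧
    J.toFun (ι x) u = dIncl ι x v) ↔ _
  constructor
  · rintro ⟨-, u, hu, hJu⟩
    rw [← hJu, J.sq_eq_neg]
    exact Submodule.neg_mem _ hu
  · intro hv
    refine ⟨⟨v, rfl⟩, -J.toFun (ι x) (dIncl ι x v), Submodule.neg_mem _ hv, ?_⟩
    rw [map_neg, J.sq_eq_neg, neg_neg]

omit [IsManifold (𝓡 (2 * n + 1)) ∞ M] in
-- The form `β` is independent of the linear form so that it can be the derivative of another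
-- contact form. This yields nonvanishing of the volume in one direction and the sign of the
-- proportionality factor in the other.
lemma exists_isBoundaryPositive (x : M)
    (β : TangentSpace (𝓡 (2 * n + 1)) x →ₗ[ℝ] TangentSpace (𝓡 (2 * n + 1)) x →ₗ[ℝ] ℝ)
    (hβ : ∀ v w, β v w = -β w v)
    (ht : ∀ v w, pullbackOneForm (𝓡 (2 * n + 1)) ι (dJ J h) x v = 0 → v ≠ 0 →
      dIncl ι x w = J.toFun (ι x) (dIncl ι x v) → 0 < β v w) :
    ∃ v : Fin (2 * n + 1) → TangentSpace (𝓡 (2 * n + 1)) x, IsBoundaryPositive J ι x v ∧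
      0 < wedgePow n (fun u => pullbackOneForm (𝓡 (2 * n + 1)) ι (dJ J h) x u)
        (fun u w => β u w) v := by
  have hU : FiniteDimensional ℝ (TangentSpace (𝓡∂ (2 * n + 2)) (ι x)) :=
    inferInstanceAs (FiniteDimensional ℝ (EuclideanSpace ℝ (Fin (2 * n + 2))))
  have hV : FiniteDimensional ℝ (TangentSpace (𝓡 (2 * n + 1)) x) :=
    inferInstanceAs (FiniteDimensional ℝ (EuclideanSpace ℝ (Fin (2 * n + 1))))
  have hU' : Module.finrank ℝ (TangentSpace (𝓡∂ (2 * n + 2)) (ι x)) = 2 * n + 2 :=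
    finrank_euclideanSpace_fin
  have hV' : Module.finrank ℝ (TangentSpace (𝓡 (2 * n + 1)) x) = 2 * n + 1 :=
    finrank_euclideanSpace_fin
  obtain ⟨eV, eU, h1, h2, h3, h4⟩ := exists_adapted_frames
    hU' hV' (J.toFun (ι x)).toLinearMap (J.sq_eq_neg (ι x))
    (dIncl ι x).toLinearMap (hι.injective_dIncl x)
    (differential (𝓡∂ (2 * n + 2)) h (ι x)).toLinearMap
    (fun h0 => hd.differential_ne_zero _ (hd.apply_inclusion hι x)
      (ContinuousLinearMap.ext fun v => LinearMap.congr_fun h0 v))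
    (fun v => hd.differential_dIncl hι x v)
    (pullbackOneForm (𝓡 (2 * n + 1)) ι (dJ J h) x).toLinearMap (fun _ => rfl) β hβ ht
  refine ⟨eV, ⟨eU 0, (hd.isOutward_iff (hd.apply_inclusion hι x) _).mpr h2, eU, h4, ?_⟩, h1⟩
  have h5 : eU.det (Fin.cons (eU 0) fun i => dIncl ι x (eV i)) = eU.det eU :=
    congrArg eU.det h3.symm
  rw [h5, Module.Basis.det_self]
  exact one_pos

omit [IsManifold (𝓡 (2 * n + 1)) ∞ M] in
lemma wedgePow_pos_of_isBoundaryPositive (x : M)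
    (β : TangentSpace (𝓡 (2 * n + 1)) x →ₗ[ℝ] TangentSpace (𝓡 (2 * n + 1)) x →ₗ[ℝ] ℝ)
    (hβ : ∀ v w, β v w = -β w v)
    (ht : ∀ v w, pullbackOneForm (𝓡 (2 * n + 1)) ι (dJ J h) x v = 0 → v ≠ 0 →
      dIncl ι x w = J.toFun (ι x) (dIncl ι x v) → 0 < β v w)
    (v : Fin (2 * n + 1) → TangentSpace (𝓡 (2 * n + 1)) x) (hv : IsBoundaryPositive J ι x v) :
    0 < wedgePow n (fun u => pullbackOneForm (𝓡 (2 * n + 1)) ι (dJ J h) x u)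
        (fun u w => β u w) v := by
  obtain ⟨Y, hY, hJ⟩ := hv
  have hU : FiniteDimensional ℝ (TangentSpace (𝓡∂ (2 * n + 2)) (ι x)) :=
    inferInstanceAs (FiniteDimensional ℝ (EuclideanSpace ℝ (Fin (2 * n + 2))))
  have hV : FiniteDimensional ℝ (TangentSpace (𝓡 (2 * n + 1)) x) :=
    inferInstanceAs (FiniteDimensional ℝ (EuclideanSpace ℝ (Fin (2 * n + 1))))
  have hU' : Module.finrank ℝ (TangentSpace (𝓡∂ (2 * n + 2)) (ι x)) = 2 * n + 2 :=
    finrank_euclideanSpace_fin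
  have hV' : Module.finrank ℝ (TangentSpace (𝓡 (2 * n + 1)) x) = 2 * n + 1 :=
    finrank_euclideanSpace_fin
  exact wedgePow_pos_of_isJPositive
    hU' hV' (J.toFun (ι x)).toLinearMap (J.sq_eq_neg (ι x))
    (dIncl ι x).toLinearMap (hι.injective_dIncl x)
    (differential (𝓡∂ (2 * n + 2)) h (ι x)).toLinearMap
    (fun v => hd.differential_dIncl hι x v)
    (pullbackOneForm (𝓡 (2 * n + 1)) ι (dJ J h) x).toLinearMap (fun _ => rfl) β hβ ht Y
    ((hd.isOutward_iff (hd.apply_inclusion hι x) _).mp hY) v hJ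

end IsBoundaryDefining

end Boundary

/-! ### From `J`-convexity to contact structures, and positivity of the Levi form on `ξ`. -/

section Main

variable {n : ℕ} {W : Type*} [TopologicalSpace W] [ChartedSpace (EuclideanHalfSpace (2 * n + 2)) W]
  [IsManifold (𝓡∂ (2 * n + 2)) ∞ W]
  {M : Type*} [TopologicalSpace M] [ChartedSpace (EuclideanSpace ℝ (Fin (2 * n + 1))) M]
  [IsManifold (𝓡 (2 * n + 1)) ∞ M] {ι : M → W}
  {J : AlmostComplexStructure (𝓡∂ (2 * n + 2)) W}

omit [IsManifold (𝓡 (2 * n + 1)) ∞ M] in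
lemma contactVolume_eq (α : (x : M) → TangentSpace (𝓡 (2 * n + 1)) x →L[ℝ] ℝ) (x : M)
    (v : Fin (2 * n + 1) → TangentSpace (𝓡 (2 * n + 1)) x) :
    contactVolume α x v = wedgePow n (fun u => α x u)
      (fun u w => extDerivLinear (𝓡 (2 * n + 1)) α x u w) v := by
  have h : extDerivOneForm (𝓡 (2 * n + 1)) α x =
      fun u w => extDerivLinear (𝓡 (2 * n + 1)) α x u w :=
    funext fun u => funext fun w => (extDerivLinear_apply α x u w).symm
  rw [contactVolume, h]

omit [IsManifold (𝓡 (2 * n + 1)) ∞ M] in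
lemma extDerivLinear_skew (α : (x : M) → TangentSpace (𝓡 (2 * n + 1)) x →L[ℝ] ℝ) (x : M)
    (v w : TangentSpace (𝓡 (2 * n + 1)) x) : extDerivLinear (𝓡 (2 * n + 1)) α x v w =
      -extDerivLinear (𝓡 (2 * n + 1)) α x w v := by
  rw [extDerivLinear_apply, extDerivLinear_apply]
  exact extDerivOneForm_skew α x v w

/-- The field of complex tangencies of a `J`-convex boundary is a tamed contact structure. -/
lemma HasJConvexBoundary.tangenciesAreTamedContact (hι : IsBoundaryInclusion (n := n) ι)
    (hW : HasJConvexBoundary J) : TangenciesAreTamedContact J ι := by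
  obtain ⟨h, hh, hle, ⟨U, -, hU, hpsh⟩, hsurj, hzero⟩ := hW
  have hd : IsBoundaryDefining (n := n) h := by
    refine ⟨hh, hle, fun p => by rw [← hzero]; rfl, fun p hp h0 => ?_⟩
    obtain ⟨v, hv⟩ := hsurj p hp (1 : ℝ)
    exact one_ne_zero (α := ℝ) (hv.symm.trans (DFunLike.congr_fun h0 v))
  set α := pullbackOneForm (𝓡 (2 * n + 1)) ι (dJ J h) with hα
  have hdα : ∀ x (v w : TangentSpace (𝓡 (2 * n + 1)) x), extDerivOneForm (𝓡 (2 * n + 1)) α x v w =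
      extDerivOneForm (𝓡∂ (2 * n + 2)) (dJ J h) (ι x) (dIncl ι x v) (dIncl ι x w) :=
    extDerivOneForm_pullback hι.contMDiff (isSmoothOneForm_dJ J hh)
  have htame : ∀ x (v w : TangentSpace (𝓡 (2 * n + 1)) x), v ≠ 0 →
      dIncl ι x w = J.toFun (ι x) (dIncl ι x v) →
      0 < extDerivOneForm (𝓡 (2 * n + 1)) α x v w := by
    intro x v w hv hw
    rw [hdα, hw]
    refine hpsh (ι x) (hU (by rw [← hι.range_eq]; exact mem_range_self x)) _ fun h0 => hv ?_
    exact hι.injective_dIncl x (h0.trans (map_zero _).symm)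
  have ht : ∀ x (v w : TangentSpace (𝓡 (2 * n + 1)) x), α x v = 0 → v ≠ 0 →
      dIncl ι x w = J.toFun (ι x) (dIncl ι x v) →
      0 < extDerivLinear (𝓡 (2 * n + 1)) α x v w := by
    intro x v w _ hv hw
    rw [extDerivLinear_apply]
    exact htame x v w hv hw
  refine ⟨α, ⟨(isSmoothOneForm_dJ J hh).pullback hι.contMDiff, fun x => ?_⟩, fun x => ?_,
    fun x v hv => ?_, fun x v _ w _ hv hw => htame x v w hv hw⟩
  · obtain ⟨v, -, hv⟩ := hd.exists_isBoundaryPositive hι J x _ (extDerivLinear_skew α x) (ht x)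
    exact ⟨v, by rw [contactVolume_eq]; exact hv.ne'⟩
  · ext v
    exact (hd.mem_complexTangencies_iff hι J x v).symm
  · rw [contactVolume_eq]
    exact hd.wedgePow_pos_of_isBoundaryPositive hι J x _ (extDerivLinear_skew α x) (ht x) v hv

/-- A linear form vanishing on the kernel of a nonzero one is a multiple of it. -/
lemma exists_eq_mul_of_ker_le {V : Type*} [AddCommGroup V] [Module ℝ V] (a b : V →ₗ[ℝ] ℝ) {r : V}
    (hr : b r ≠ 0) (h : ∀ v, b v = 0 → a v = 0) : ∃ c : ℝ, ∀ v, a v = c * b v := by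
  refine ⟨a r / b r, fun v => ?_⟩
  have h1 := h (v - (b v / b r) • r) (by
    rw [map_sub, map_smul, smul_eq_mul, div_mul_cancel₀ _ hr, sub_self])
  rw [map_sub, map_smul, smul_eq_mul, sub_eq_zero] at h1
  rw [h1]
  ring

lemma wedgePow_const_mul {V : Type*} (m : ℕ) (c : ℝ) (a : V → ℝ) (β : V → V → ℝ)
    (v : Fin (2 * m + 1) → V) : wedgePow m (fun u => c * a u) β v = c * wedgePow m a β v := by
  simp only [wedgePow, Finset.mul_sum]
  exact Finset.sum_congr rfl fun σ _ => by ring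

/-- If the complex tangencies are a tamed contact structure, the Levi form of any boundary defining
function is positive on them. -/
lemma IsBoundaryDefining.levi_pos {h : W → ℝ} (hd : IsBoundaryDefining (n := n) h)
    (hι : IsBoundaryInclusion (n := n) ι) (hM : TangenciesAreTamedContact J ι) (x : M)
    (v w : TangentSpace (𝓡 (2 * n + 1)) x)
    (hv : pullbackOneForm (𝓡 (2 * n + 1)) ι (dJ J h) x v = 0) (hv0 : v ≠ 0)
    (hw : dIncl ι x w = J.toFun (ι x) (dIncl ι x v)) :
    0 < extDerivOneForm (𝓡∂ (2 * n + 2)) (dJ J h) (ι x) (dIncl ι x v) (dIncl ι x w) := by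
  obtain ⟨α, ⟨hα, hvol⟩, hker, hor, htame⟩ := hM
  set α₀ := pullbackOneForm (𝓡 (2 * n + 1)) ι (dJ J h) with hα₀
  have hα₀s : IsSmoothOneForm (𝓡 (2 * n + 1)) α₀ :=
    (isSmoothOneForm_dJ J hd.contMDiff).pullback hι.contMDiff
  have hker' : ∀ x u, α x u = 0 ↔ α₀ x u = 0 := fun x u => by
    rw [← hd.mem_complexTangencies_iff hι J x u, ← hker]
    rfl
  have hne : ∀ x, ∃ r, α₀ x r ≠ 0 := by
    intro x
    by_contra! h0
    obtain ⟨e, he⟩ := hvol x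
    refine he ?_
    simp only [contactVolume, wedgePow, (hker' x _).mpr (h0 _), mul_zero, zero_mul,
      Finset.sum_const_zero]
  have hprop : ∀ x, ∃ c : ℝ, ∀ u, α x u = c * α₀ x u := fun x => by
    obtain ⟨r, hr⟩ := hne x
    exact exists_eq_mul_of_ker_le (α x).toLinearMap (α₀ x).toLinearMap hr
      fun u hu => (hker' x u).mpr hu
  have hw0 : α₀ x w = 0 := by
    have h1 : α₀ x w = -differential (𝓡∂ (2 * n + 2)) h (ι x)
      (J.toFun (ι x) (dIncl ι x w)) := rfl
    rw [h1, hw, J.sq_eq_neg, map_neg, hd.differential_dIncl hι, neg_zero, neg_zero]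
  have ht : ∀ u z, α₀ x u = 0 → u ≠ 0 → dIncl ι x z = J.toFun (ι x) (dIncl ι x u) →
      0 < extDerivLinear (𝓡 (2 * n + 1)) α x u z := by
    intro u z hu hu0 hz
    rw [extDerivLinear_apply]
    refine htame x u ((hd.mem_complexTangencies_iff hι J x u).mpr hu) z
      ((hd.mem_complexTangencies_iff hι J x z).mpr ?_) hu0 hz
    have h1 : α₀ x z = -differential (𝓡∂ (2 * n + 2)) h (ι x)
      (J.toFun (ι x) (dIncl ι x z)) := rfl
    refine h1.trans ?_
    rw [hz, J.sq_eq_neg, map_neg, hd.differential_dIncl hι, neg_zero, neg_zero]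
  obtain ⟨c, hc⟩ := hprop x
  -- On a boundary-positive frame, linear algebra makes `α₀ ∧ (dα)^n` positive because `dα` tames
  -- `J` on `ξ`, while the orientation hypothesis makes `α ∧ (dα)^n = c · α₀ ∧ (dα)^n` positive.
  have hcpos : 0 < c := by
    obtain ⟨e, he, hpos⟩ := hd.exists_isBoundaryPositive hι J x _ (extDerivLinear_skew α x) ht
    have h1 := hor x e he
    rw [contactVolume_eq] at h1
    simp only [hc] at h1
    rw [wedgePow_const_mul] at h1
    exact pos_of_mul_pos_left h1 hpos.le
  obtain ⟨r, hr⟩ := hne x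
  have h1 := extDerivOneForm_of_proportional hα hα₀s hprop x r v w hv hw0
  rw [hc, mul_comm c, mul_assoc] at h1
  have h2 := mul_left_cancel₀ hr h1
  have h3 := ht v w hv hv0 hw
  rw [extDerivLinear_apply, h2] at h3
  have h4 := extDerivOneForm_pullback hι.contMDiff (isSmoothOneForm_dJ J hd.contMDiff) x v w
  exact (pos_of_mul_pos_right h3 hcpos.le).trans_eq h4

end Main

/-! ### From contact structures to `J`-convexity. -/

section Converse

variable {n : ℕ} {W : Type*} [TopologicalSpace W] [ChartedSpace (EuclideanHalfSpace (2 * n + 2)) W]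
  [IsManifold (𝓡∂ (2 * n + 2)) ∞ W] {J : AlmostComplexStructure (𝓡∂ (2 * n + 2)) W}

omit [IsManifold (𝓡∂ (2 * n + 2)) ∞ W] in
lemma contMDiff_mul_exp {h c : W → ℝ} (hh : ContMDiff (𝓡∂ (2 * n + 2)) 𝓘(ℝ, ℝ) ∞ h)
    (hc : ContMDiff (𝓡∂ (2 * n + 2)) 𝓘(ℝ, ℝ) ∞ c) :
    ContMDiff (𝓡∂ (2 * n + 2)) 𝓘(ℝ, ℝ) ∞ fun q => h q * Real.exp (c q * h q / 2) :=
  hh.mul ((Real.contDiff_exp.contMDiff (n := ∞)).comp ((hc.mul hh).div_const 2))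

/-- The Levi form of `h * exp (c * h / 2)` on the zero set of `h`. -/
lemma extDerivOneForm_dJ_mul_exp_apply_J {h c : W → ℝ}
    (hh : ContMDiff (𝓡∂ (2 * n + 2)) 𝓘(ℝ, ℝ) ∞ h) (hc : ContMDiff (𝓡∂ (2 * n + 2)) 𝓘(ℝ, ℝ) ∞ c)
    {p : W} (hp : h p = 0) (v : TangentSpace (𝓡∂ (2 * n + 2)) p) :
    extDerivOneForm (𝓡∂ (2 * n + 2)) (dJ J fun q => h q * Real.exp (c q * h q / 2)) p v
        (J.toFun p v) =
      extDerivOneForm (𝓡∂ (2 * n + 2)) (dJ J h) p v (J.toFun p v) +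
        c p * (differential (𝓡∂ (2 * n + 2)) h p v ^ 2 +
          differential (𝓡∂ (2 * n + 2)) h p (J.toFun p v) ^ 2) := by
  rw [extDerivOneForm_dJ_mul_exp J hh hc hp (contMDiff_mul_exp hh hc)]
  have h1 : ∀ u, dJ J h p u = -differential (𝓡∂ (2 * n + 2)) h p (J.toFun p u) := fun _ => rfl
  rw [h1, h1, J.sq_eq_neg, map_neg]
  ring

variable {M : Type*} [TopologicalSpace M] [ChartedSpace (EuclideanSpace ℝ (Fin (2 * n + 1))) M]
  [IsManifold (𝓡 (2 * n + 1)) ∞ M] {ι : M → W}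

lemma IsBoundaryDefining.exists_const_levi_pos {h : W → ℝ} (hd : IsBoundaryDefining (n := n) h)
    (hι : IsBoundaryInclusion (n := n) ι) (hM : TangenciesAreTamedContact J ι) {p : W}
    (hp : h p = 0) : ∃ c : ℝ, ∀ v : TangentSpace (𝓡∂ (2 * n + 2)) p, v ≠ 0 →
      0 < extDerivOneForm (𝓡∂ (2 * n + 2)) (dJ J h) p v (J.toFun p v) +
        c * (differential (𝓡∂ (2 * n + 2)) h p v ^ 2 +
          differential (𝓡∂ (2 * n + 2)) h p (J.toFun p v) ^ 2) := by
  let l : EuclideanSpace ℝ (Fin (2 * n + 2)) →L[ℝ] ℝ := differential (𝓡∂ (2 * n + 2)) h p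
  let j : EuclideanSpace ℝ (Fin (2 * n + 2)) →L[ℝ] EuclideanSpace ℝ (Fin (2 * n + 2)) := J.toFun p
  let B : EuclideanSpace ℝ (Fin (2 * n + 2)) →L[ℝ] EuclideanSpace ℝ (Fin (2 * n + 2)) →L[ℝ] ℝ :=
    fderivWithin ℝ (oneFormInChart (𝓡∂ (2 * n + 2)) (dJ J h) p) (range (𝓡∂ (2 * n + 2)))
      (extChartAt (𝓡∂ (2 * n + 2)) p p)
  have hB : ∀ v w, extDerivOneForm (𝓡∂ (2 * n + 2)) (dJ J h) p v w = B v w - B w v := fun v w =>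
    extDerivOneForm_eq_curlWithin _ _ _ _
  -- The added quadratic term vanishes exactly when `v` and `Jv` are both tangent to the boundary,
  -- that is on `ξ`, where `levi_pos` applies.
  have hpos : ∀ v, v ≠ 0 → l v ^ 2 + l (j v) ^ 2 = 0 → 0 < B v (j v) - B (j v) v := by
    intro v hv hN
    have hl1 : l v = 0 := by nlinarith [sq_nonneg (l v), sq_nonneg (l (j v))]
    have hl2 : l (j v) = 0 := by nlinarith [sq_nonneg (l v), sq_nonneg (l (j v))]
    obtain ⟨x, rfl⟩ : p ∈ range ι := by
      rw [hι.range_eq]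
      exact (hd.eq_zero_iff p).mp hp
    have hr := hd.range_dIncl hι x
    obtain ⟨u, hu⟩ : v ∈ LinearMap.range (dIncl ι x).toLinearMap := by
      rw [hr]
      exact hl1
    obtain ⟨w, hw⟩ : j v ∈ LinearMap.range (dIncl ι x).toLinearMap := by
      rw [hr]
      exact hl2
    have hu' : dIncl ι x u = v := hu
    have hw' : dIncl ι x w = j v := hw
    have h1 := hd.levi_pos hι hM x u w (by
        change -differential (𝓡∂ (2 * n + 2)) h (ι x) (J.toFun (ι x) (dIncl ι x u)) = 0
        rw [hu']
        exact neg_eq_zero.mpr hl2)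
      (by rintro rfl; exact hv (hu'.symm.trans (map_zero _))) (by rw [hu']; exact hw')
    rw [hu', hw'] at h1
    exact h1.trans_eq (hB _ _)
  obtain ⟨c, hc⟩ := exists_forall_add_mul_pos (Q := fun v => B v (j v) - B (j v) v)
    (N := fun v => l v ^ 2 + l (j v) ^ 2) (by fun_prop) (by fun_prop)
    (fun r v => by simp only [map_smul, smul_apply, smul_eq_mul]; ring)
    (fun r v => by simp only [map_smul, smul_eq_mul]; ring)
    (fun v => by positivity) hpos
  refine ⟨c, fun v hv => ?_⟩
  rw [hB]
  exact hc v hv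

/-- If the complex tangencies of the boundary are a tamed contact structure, then the boundary is
`J`-convex. -/
lemma TangenciesAreTamedContact.hasJConvexBoundary [T2Space W] [SigmaCompactSpace W]
    (hι : IsBoundaryInclusion (n := n) ι) (hM : TangenciesAreTamedContact J ι) :
    HasJConvexBoundary J := by
  obtain ⟨h, hh, hle, hzero, hdiff⟩ := exists_boundary_defining_function (m := 2 * n + 2) (W := W)
  have hd : IsBoundaryDefining (n := n) h := ⟨hh, hle, hzero, hdiff⟩
  let N : (p : W) → TangentSpace (𝓡∂ (2 * n + 2)) p → ℝ := fun p v =>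
    differential (𝓡∂ (2 * n + 2)) h p v ^ 2 +
      differential (𝓡∂ (2 * n + 2)) h p (J.toFun p v) ^ 2
  let Q : (p : W) → TangentSpace (𝓡∂ (2 * n + 2)) p → ℝ := fun p v =>
    extDerivOneForm (𝓡∂ (2 * n + 2)) (dJ J h) p v (J.toFun p v)
  -- The constants admissible at `p`: a condition at boundary points only, and all of `ℝ` elsewhere.
  -- It is convex because it is closed upwards, as `N ≥ 0`.
  let t : W → Set ℝ := fun p => {c | h p = 0 → ∀ v, v ≠ 0 → 0 < Q p v + c * N p v}
  have ht : ∀ p, Convex ℝ (t p) := by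
    intro p
    refine OrdConnected.convex ⟨fun a ha b hb c hc hp v hv => ?_⟩
    have hN : 0 ≤ N p v := by positivity
    have h1 := ha hp v hv
    nlinarith [hc.1]
  have hloc : ∀ p, ∃ c : ℝ, ∀ᶠ q in 𝓝 p, c ∈ t q := by
    intro p
    by_cases hp : h p = 0
    · obtain ⟨c, hc⟩ := hd.exists_const_levi_pos hι hM hp
      have hcs : ContMDiff (𝓡∂ (2 * n + 2)) 𝓘(ℝ, ℝ) ∞ fun _ : W => c := contMDiff_const
      -- With `c` held constant, openness of plurisubharmonicity at `p` shows that the same `c` is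
      -- admissible at all nearby boundary points.
      have h1 := eventually_plurisubharmonic J (contMDiff_mul_exp hh hcs) (p := p)
        (fun v hv => by
          rw [extDerivOneForm_dJ_mul_exp_apply_J hh hcs hp]
          exact hc v hv)
      refine ⟨c, h1.mono fun q hq hq0 v hv => ?_⟩
      have h2 := hq v hv
      rwa [extDerivOneForm_dJ_mul_exp_apply_J hh hcs hq0] at h2
    · refine ⟨0, ?_⟩
      filter_upwards [hh.continuous.continuousAt.eventually_ne hp] with q hq h0
      exact absurd h0 hq
  obtain ⟨C, hC⟩ := exists_contMDiffMap_forall_mem_convex_of_local_const (𝓡∂ (2 * n + 2)) ht hloc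
  have hCs : ContMDiff (𝓡∂ (2 * n + 2)) 𝓘(ℝ, ℝ) ∞ C := C.contMDiff
  set k : W → ℝ := fun q => h q * Real.exp (C q * h q / 2) with hk
  have hks : ContMDiff (𝓡∂ (2 * n + 2)) 𝓘(ℝ, ℝ) ∞ k := contMDiff_mul_exp hh hCs
  have hk0 : ∀ p, k p = 0 ↔ h p = 0 := fun p => by simp [hk, Real.exp_ne_zero]
  refine ⟨k, hks, fun p => mul_nonpos_of_nonpos_of_nonneg (hle p) (Real.exp_pos _).le,
    ⟨interior {q | ∀ v : TangentSpace (𝓡∂ (2 * n + 2)) q, v ≠ 0 →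
      0 < extDerivOneForm (𝓡∂ (2 * n + 2)) (dJ J k) q v (J.toFun q v)}, isOpen_interior,
      fun p hp => ?_, fun p hp => interior_subset hp⟩, fun p hp => ?_, ?_⟩
  · rw [mem_interior_iff_mem_nhds]
    have hp0 := (hzero p).mpr hp
    refine eventually_plurisubharmonic J hks fun v hv => ?_
    rw [hk, extDerivOneForm_dJ_mul_exp_apply_J hh hCs hp0]
    exact hC p hp0 v hv
  · have hp0 := (hk0 p).mp hp
    obtain ⟨v, hv⟩ : ∃ v, differential (𝓡∂ (2 * n + 2)) h p v ≠ 0 := by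
      by_contra! h0
      exact hdiff p hp0 (ContinuousLinearMap.ext h0)
    have hu : ContMDiff (𝓡∂ (2 * n + 2)) 𝓘(ℝ, ℝ) ∞ fun q => Real.exp (C q * h q / 2) :=
      (Real.contDiff_exp.contMDiff (n := ∞)).comp ((hCs.mul hh).div_const 2)
    have h1 := ((hh.mdifferentiable (by simp) p).hasMFDerivAt.mul
      (hu.mdifferentiable (by simp) p).hasMFDerivAt).mfderiv
    -- At a zero of `h` the exponential equals `1` and its own derivative is multiplied by `0`, so
    -- `dk = dh` there and `0` stays a regular value.
    have h2 : differential (𝓡∂ (2 * n + 2)) k p v =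
        h p * differential (𝓡∂ (2 * n + 2)) (fun q => Real.exp (C q * h q / 2)) p v +
        Real.exp (C p * h p / 2) * differential (𝓡∂ (2 * n + 2)) h p v :=
      DFunLike.congr_fun h1 v
    rw [hp0, mul_zero, zero_div, Real.exp_zero, one_mul, zero_mul, zero_add] at h2
    intro y
    let y' : ℝ := y
    refine ⟨(y' / differential (𝓡∂ (2 * n + 2)) h p v) • v, ?_⟩
    have h3 : differential (𝓡∂ (2 * n + 2)) k p
        ((y' / differential (𝓡∂ (2 * n + 2)) h p v) • v) = y' := by
      rw [map_smul, h2, smul_eq_mul, div_mul_cancel₀ _ hv]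
    exact h3
  · ext p
    exact (hk0 p).trans (hzero p)

end Converse

end JConvex

end

theorem mainTheorem7 (n : ℕ)
    (W : Type*) [TopologicalSpace W] [T2Space W] [SecondCountableTopology W]
    [ChartedSpace (EuclideanHalfSpace (2 * n + 2)) W] [IsManifold (𝓡∂ (2 * n + 2)) ∞ W]
    (M : Type*) [TopologicalSpace M]
    [ChartedSpace (EuclideanSpace ℝ (Fin (2 * n + 1))) M] [IsManifold (𝓡 (2 * n + 1)) ∞ M]
    (ι : M → W) (hι : JConvex.IsBoundaryInclusion (n := n) ι)
    (J : JConvex.AlmostComplexStructure (𝓡∂ (2 * n + 2)) W) :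
    JConvex.HasJConvexBoundary J ↔ JConvex.TangenciesAreTamedContact J ι := by
  have := Manifold.locallyCompact_of_finiteDimensional (𝓡∂ (2 * n + 2)) (M := W)
  have := sigmaCompactSpace_of_locallyCompact_secondCountable (X := W)
  exact ⟨fun h => h.tangenciesAreTamedContact hι, fun h => h.hasJConvexBoundary hι⟩
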